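/- **Setting.** Let $n\ge 2$, $p\ge 1$, $k\ge 1$ be integers and let $(X_1,Y_1),\dots,(X_n,Y_n)$ be independent (not necessarily identically distributed) random vectors in $\mathbb R^p\times\mathbb R$. Let $\beta_0\in\mathbb R^p$ have at most $k$ non-zero coordinates, put $\varepsilon_i:=Y_i-X_i^\top\beta_0$, and assume $\frac1n\sum_{i=1}^n\mathbb E[\varepsilon_iX_i]=0$ (the linear model may be misspecified). For a real random variable $W$ and $a>0$ let $\|W\|_{\psi_a}:=\inf\{\eta>0:\mathbb E[\exp((|W|/\eta)^a)-1]\le 1\}$ (with $\inf\emptyset=\infty$), and for a random vector $X$ let $\|X\|_{M,\psi_a}:=\max_j\|X(j)\|_{\psi_a}$. Assume that for some $0<\alpha\le 2$, $\vartheta>0$ and $K>0$, $$\max\{\|X_i\|_{M,\psi_\alpha},\ \|\varepsilon_i\|_{\psi_\vartheta}\}\le K\qquad\text{for all }1\le i\le n .$$ Define $$\Sigma_n:=\frac1n\sum_{i=1}^n\mathbb E[X_iX_i^\top],\qquad \Upsilon_{n,k}:=\sup_{\|\theta\|_0\le k,\ \|\theta\|_2=1}\frac1n\sum_{i=1}^n\mathrm{Var}\big((X_i^\top\theta)^2\big),\qquad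 \sigma_{n,p}^2:=\max_{1\le j\le p}\frac1n\sum_{i=1}^n\mathrm{Var}(X_i(j)\varepsilon_i),$$ $$\Xi_{n,k}^{(M)}:=14\sqrt2\sqrt{\frac{\Upsilon_{n,k}\,k\log(36np/k)}{n}}+\frac{C_\alpha K^2k(\log(2n))^{2/\alpha}(k\log(36np/k))^{2/\alpha}}{n},$$ and let $\frac1\gamma:=\frac1\alpha+\frac1\vartheta$ and $\gamma^*:=\min\{\gamma,1\}$. For $\lambda>0$ a Lasso estimator $\hat\beta_n(\lambda)$ is any minimizer over $\theta\in\mathbb R^p$ of $\frac1{2n}\sum_{i=1}^n(Y_i-X_i^\top\theta)^2+\lambda\|\theta\|_1$. **Theorem.** There are constants $C_\alpha>0$ depending only on $\alpha$ and $C_\gamma,C'_\gamma>0$ depending only on $\gamma$ such that, in the setting above, if the smallest eigenvalue of $\Sigma_n$ satisfies $\lambda_{\min}(\Sigma_n)\ge 1782\,\Xi_{n,k}^{(M)}$, then for $$\lambda_n:=14\sqrt2\,\sigma_{n,p}\sqrt{\frac{\log(np)}{n}}+\frac{C_\gamma K^2(\log(2n))^{1/\gamma}(2\log(np))^{1/\gamma^*}}{n}$$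 the following holds with probability at least $1-3(np)^{-1}-3k(np)^{-1}$: a Lasso estimator $\hat\beta_n(\lambda_n)$ exists, and every Lasso estimator $\hat\beta_n(\lambda_n)$ satisfies $$\|\hat\beta_n(\lambda_n)-\beta_0\|_2\le\frac{84\sqrt2}{\lambda_{\min}(\Sigma_n)}\left[\sigma_{n,p}\sqrt{\frac{k\log(np)}{n}}+\frac{C'_\gamma K^2k^{1/2}(\log(np))^{1/\gamma+1/\gamma^*}}{n}\right].$$ (When $\gamma\le1$ one has $\gamma^*=\gamma$, and the last exponent is $2/\gamma$.) -/

import Mathlib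

open MeasureTheory ProbabilityTheory
open scoped ENNReal

noncomputable section

namespace SubWeibullLasso

/-- The `g`-Orlicz norm `inf {η > 0 : E[g(|Z|/η)] ≤ 1}` of a real random variable, with values in
`[0, ∞]`, so that it is `∞` when no `η` is admissible. -/
def orliczNorm {Ω : Type*} [MeasurableSpace Ω] (μ : Measure Ω) (g : ℝ → ℝ) (Z : Ω → ℝ) : ℝ≥0∞ :=
  sInf {x : ℝ≥0∞ | ∃ η : ℝ, 0 < η ∧ x = ENNReal.ofReal η ∧
    ∫⁻ ω, ENNReal.ofReal (g (|Z ω| / η)) ∂μ ≤ 1}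

/-- The function `ψ_α(x) = exp(x^α) - 1` (used for `x ≥ 0`). -/
def psi (α : ℝ) (x : ℝ) : ℝ := Real.exp (x ^ α) - 1

/-- The marginal sub-Weibull norm of a random vector. -/
def marginalNorm {Ω : Type*} [MeasurableSpace Ω] (μ : Measure Ω) {p : ℕ} (α : ℝ)
    (Z : Ω → EuclideanSpace ℝ (Fin p)) : ℝ≥0∞ :=
  ⨆ j : Fin p, orliczNorm μ (psi α) (fun ω => Z ω j)

/-- The number of non-zero coordinates. -/
def l0 {p : ℕ} (θ : EuclideanSpace ℝ (Fin p)) : ℕ := hammingNorm (fun j => θ j)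

/-- The `L₁` norm. -/
def l1 {p : ℕ} (θ : EuclideanSpace ℝ (Fin p)) : ℝ := ∑ j, |θ j|

/-- The population gram matrix `Σ_n = n⁻¹ ∑ E[X_i X_iᵀ]`. -/
def gram {Ω : Type*} [MeasurableSpace Ω] (μ : Measure Ω) {n p : ℕ}
    (X : Fin n → Ω → EuclideanSpace ℝ (Fin p)) : Matrix (Fin p) (Fin p) ℝ :=
  Matrix.of fun a b => (1 / (n : ℝ)) * ∑ i, ∫ ω, X i ω a * X i ω b ∂μ

/-- The smallest (real) eigenvalue. -/
def lambdaMin {p : ℕ} (A : Matrix (Fin p) (Fin p) ℝ) : ℝ := sInf (spectrum ℝ A)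

/-- The set `Θ_k` of `k`-sparse vectors of unit Euclidean norm. -/
def sparseSphere (p k : ℕ) : Set (EuclideanSpace ℝ (Fin p)) := {θ | l0 θ ≤ k ∧ ‖θ‖ = 1}

/-- `Υ_{n,k} = sup_{θ ∈ Θ_k} n⁻¹ ∑ Var((X_iᵀθ)²)`. -/
def Upsilon {Ω : Type*} [MeasurableSpace Ω] (μ : Measure Ω) {n p : ℕ}
    (X : Fin n → Ω → EuclideanSpace ℝ (Fin p)) (k : ℕ) : ℝ :=
  sSup ((fun θ : EuclideanSpace ℝ (Fin p) =>
    (1 / (n : ℝ)) * ∑ i, variance (fun ω => (inner ℝ (X i ω) θ) ^ 2) μ) '' sparseSphere p k)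

/-- `Ξ_{n,k}^{(M)}`, with `C` in the place of the constant `C_α`. -/
def Xi {Ω : Type*} [MeasurableSpace Ω] (μ : Measure Ω) {n p : ℕ}
    (X : Fin n → Ω → EuclideanSpace ℝ (Fin p)) (k : ℕ) (α K C : ℝ) : ℝ :=
  14 * √2 * √(Upsilon μ X k * k * Real.log (36 * n * p / k) / n) +
    C * K ^ 2 * k * (Real.log (2 * n)) ^ (2 / α) *
      (k * Real.log (36 * n * p / k)) ^ (2 / α) / n

/-- The error `ε_i = Y_i - X_iᵀβ`. -/
def err {Ω : Type*} {n p : ℕ} (X : Fin n → Ω → EuclideanSpace ℝ (Fin p)) (Y : Fin n → Ω → ℝ)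
    (β : EuclideanSpace ℝ (Fin p)) (i : Fin n) (ω : Ω) : ℝ :=
  Y i ω - inner ℝ (X i ω) β

/-- `σ_{n,p}`, the square root of `max_j n⁻¹ ∑ Var(X_i(j) ε_i)`. -/
def sigma {Ω : Type*} [MeasurableSpace Ω] (μ : Measure Ω) {n p : ℕ}
    (X : Fin n → Ω → EuclideanSpace ℝ (Fin p)) (Y : Fin n → Ω → ℝ)
    (β : EuclideanSpace ℝ (Fin p)) : ℝ :=
  √(⨆ j : Fin p, (1 / (n : ℝ)) * ∑ i, variance (fun ω => X i ω j * err X Y β i ω) μ)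

/-- The Lasso objective for data `x_i, y_i` and regularization parameter `lam`. -/
def lassoObjective {n p : ℕ} (x : Fin n → EuclideanSpace ℝ (Fin p)) (y : Fin n → ℝ) (lam : ℝ)
    (θ : EuclideanSpace ℝ (Fin p)) : ℝ :=
  (1 / (2 * (n : ℝ))) * ∑ i, (y i - inner ℝ (x i) θ) ^ 2 + lam * l1 θ

/-- `b` is a Lasso estimator, i.e. a minimizer of the Lasso objective over `ℝ^p`. -/
def IsLasso {n p : ℕ} (x : Fin n → EuclideanSpace ℝ (Fin p)) (y : Fin n → ℝ) (lam : ℝ)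
    (b : EuclideanSpace ℝ (Fin p)) : Prop :=
  IsMinOn (lassoObjective x y lam) Set.univ b

/-- The regularization parameter `λ_n`, with `C` in the place of the constant `C_γ`. -/
def lamChoice (n p : ℕ) (γ K C s : ℝ) : ℝ :=
  14 * √2 * s * √(Real.log (n * p) / n) +
    C * K ^ 2 * (Real.log (2 * n)) ^ (1 / γ) * (2 * Real.log (n * p)) ^ (1 / min γ 1) / n

end SubWeibullLasso

end

namespace SubWeibullLasso

/-! Write r for the smallest eigenvalue of the population Gram matrix. By the deterministic bound
`IsLasso.norm_sub_le`, two events suffice: λ dominates twice the sup norm of the score, and the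
empirical Gram form is at least (r/2)‖δ‖² on the cone ‖δ‖₁ ≤ 4√k‖δ‖₂.

Both events come from clipping at the level where the normalised exponent b = (|x|/κ)^a equals τ = 2
log(2n). Clipped variables obey Bernstein's inequality, with a variance no larger than the original.
The clipping bias carries a factor exp(-τ/2) = 1/(2n), so n biases add up to a constant. The
excesses of the exponents over τ have a sum of constant order with an exponential tail
(`measure_sum_excess_le`). For the score this gives `measure_abs_sum_gt_le` and then `score_event`.

For the cone, let S and T be the population and empirical Gram matrices of the clipped data.
Positivity of T gives δ'Tδ ≥ 2δ'Tη - η'Tη for every η, so if η'Sη ≤ δ'Sη, then δ'Tδ is at least η'Sη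
up to the sup norm of (T - S)η. Such an η is a minimizer of the S-form over a slice {‖θ‖₁ ≤ 4√k, u·θ
≥ 3/4}, where u is a rounding of δ. There are at most (2p+1)^(64k) roundings, so finitely many η
serve all δ (`exists_certificates`). The variance of (x'η)x_j is at most M²E(x'η)², so (T - S)η
concentrates relative to η'Sη itself (`measure_gram_direction_le`). Hence the second summand of Ξ
alone yields `restricted_eigenvalue`. -/

/-- A non-negative random variable `b` with `E[exp b] ≤ 2`. -/
structure ExpMoment {Ω : Type*} [MeasurableSpace Ω] (μ : Measure Ω) (b : Ω → ℝ) : Prop where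
  meas : Measurable b
  nonneg : ∀ ω, 0 ≤ b ω
  integrable : Integrable (fun ω => Real.exp (b ω)) μ
  integral_le : ∫ ω, Real.exp (b ω) ∂μ ≤ 2

/-! ### Exponential moments and the polynomial moments they control. -/

section Moments

variable {Ω : Type*} [MeasurableSpace Ω] {μ : Measure Ω}

/-- Raise y ≤ exp y to the power s at y = b/(2s). The unused half of the exponent becomes the factor
exp(-τ/2) in `ExpMoment.tail_moment`. -/
lemma rpow_le_exp_half {b s : ℝ} (hb : 0 ≤ b) (hs : 0 < s) :
    b ^ s ≤ (2 * s) ^ s * Real.exp (b / 2) := by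
  have h1 : b / (2 * s) ≤ Real.exp (b / (2 * s)) := by
    linarith [Real.add_one_le_exp (b / (2 * s))]
  have h2 : (b / (2 * s)) ^ s ≤ Real.exp (b / (2 * s)) ^ s :=
    Real.rpow_le_rpow (by positivity) h1 hs.le
  rw [Real.div_rpow hb (by positivity), div_le_iff₀ (by positivity), ← Real.exp_mul] at h2
  have h3 : b / (2 * s) * s = b / 2 := by field_simp
  rw [h3] at h2
  linarith

/-- The slack between K and 2K produces an admissible η below 2K, whether or not the infimum is
attained. This is the origin of the scale 2K used later. -/
lemma expMoment_of_orliczNorm_le [IsProbabilityMeasure μ] {Z : Ω → ℝ} (hZ : Measurable Z)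
    {a K : ℝ} (ha : 0 < a) (hK : 0 < K) (h : orliczNorm μ (psi a) Z ≤ ENNReal.ofReal K) :
    ExpMoment μ (fun ω => (|Z ω| / (2 * K)) ^ a) := by
  have h1 : orliczNorm μ (psi a) Z < ENNReal.ofReal (2 * K) :=
    h.trans_lt ((ENNReal.ofReal_lt_ofReal_iff (by positivity)).2 (by linarith))
  obtain ⟨x, ⟨η, hη, rfl, hint⟩, hlt⟩ := sInf_lt_iff.1 h1
  have hη2 : η < 2 * K := (ENNReal.ofReal_lt_ofReal_iff (by positivity)).1 hlt
  have hm : Measurable (fun ω => (|Z ω| / (2 * K)) ^ a) :=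
    ((measurable_norm.comp hZ).div_const _).pow_const _
  have hle : ∫⁻ ω, ENNReal.ofReal (Real.exp ((|Z ω| / (2 * K)) ^ a) - 1) ∂μ ≤ 1 := by
    refine le_trans (lintegral_mono fun ω => ENNReal.ofReal_le_ofReal ?_) hint
    unfold psi
    have : (|Z ω| / (2 * K)) ^ a ≤ (|Z ω| / η) ^ a :=
      Real.rpow_le_rpow (by positivity) (by gcongr) ha.le
    linarith [Real.exp_le_exp.2 this]
  have hnn : ∀ ω, 0 ≤ Real.exp ((|Z ω| / (2 * K)) ^ a) - 1 := fun ω => by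
    have : 0 ≤ (|Z ω| / (2 * K)) ^ a := by positivity
    linarith [Real.add_one_le_exp ((|Z ω| / (2 * K)) ^ a)]
  have hi : Integrable (fun ω => Real.exp ((|Z ω| / (2 * K)) ^ a) - 1) μ := by
    refine ⟨(hm.exp.sub_const _).aestronglyMeasurable, ?_⟩
    rw [hasFiniteIntegral_iff_ofReal (Filter.Eventually.of_forall hnn)]
    exact hle.trans_lt ENNReal.one_lt_top
  have hi2 : Integrable (fun ω => Real.exp ((|Z ω| / (2 * K)) ^ a)) μ := by
    have := hi.add (integrable_const (1 : ℝ))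
    refine this.congr (Filter.Eventually.of_forall fun ω => ?_)
    simp
  refine ⟨hm, fun ω => by positivity, hi2, ?_⟩
  have h3 : ∫ ω, (Real.exp ((|Z ω| / (2 * K)) ^ a) - 1) ∂μ ≤ 1 := by
    rw [integral_eq_lintegral_of_nonneg_ae (Filter.Eventually.of_forall hnn)
      hi.aestronglyMeasurable]
    exact ENNReal.toReal_le_of_le_ofReal zero_le_one (by simpa using hle)
  rw [integral_sub hi2 (integrable_const _)] at h3
  simp at h3
  linarith

/-- A convex combination of exponents keeps the exponential moment bound. -/
lemma ExpMoment.of_le_convex {b₁ b₂ b : Ω → ℝ} (h₁ : ExpMoment μ b₁) (h₂ : ExpMoment μ b₂)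
    (hb : Measurable b) (hb0 : ∀ ω, 0 ≤ b ω) {w₁ w₂ : ℝ} (hw₁ : 0 ≤ w₁) (hw₂ : 0 ≤ w₂)
    (hw : w₁ + w₂ = 1) (hle : ∀ ω, b ω ≤ w₁ * b₁ ω + w₂ * b₂ ω) : ExpMoment μ b := by
  have hp : ∀ ω, Real.exp (b ω) ≤ w₁ * Real.exp (b₁ ω) + w₂ * Real.exp (b₂ ω) := fun ω =>
    (Real.exp_le_exp.2 (hle ω)).trans (by
      simpa using convexOn_exp.2 (Set.mem_univ (b₁ ω)) (Set.mem_univ (b₂ ω)) hw₁ hw₂ hw)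
  have hi := (h₁.integrable.const_mul w₁).add (h₂.integrable.const_mul w₂)
  have hi' : Integrable (fun ω => Real.exp (b ω)) μ :=
    hi.mono' hb.exp.aestronglyMeasurable (Filter.Eventually.of_forall fun ω => by
      simpa [abs_of_pos (Real.exp_pos _)] using hp ω)
  refine ⟨hb, hb0, hi', (integral_mono hi' hi hp).trans ?_⟩
  simp only [Pi.add_apply]
  rw [integral_add (h₁.integrable.const_mul w₁) (h₂.integrable.const_mul w₂),
    integral_const_mul, integral_const_mul]
  nlinarith [h₁.integral_le, h₂.integral_le]

lemma ExpMoment.moment {b : Ω → ℝ} (h : ExpMoment μ b) {g : Ω → ℝ} (hg : Measurable g)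
    {c s : ℝ} (hc : 0 ≤ c) (hs : 0 < s) (hle : ∀ ω, |g ω| ≤ c * b ω ^ s) :
    Integrable g μ ∧ ∫ ω, |g ω| ∂μ ≤ 2 * c * (2 * s) ^ s := by
  have hp : ∀ ω, |g ω| ≤ c * (2 * s) ^ s * Real.exp (b ω) := fun ω => by
    refine (hle ω).trans ?_
    rw [mul_assoc]
    gcongr
    refine (rpow_le_exp_half (h.nonneg ω) hs).trans ?_
    gcongr
    linarith [h.nonneg ω]
  have hi := h.integrable.const_mul (c * (2 * s) ^ s)
  have hi' : Integrable g μ := hi.mono' hg.aestronglyMeasurable (Filter.Eventually.of_forall hp)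
  refine ⟨hi', (integral_mono hi'.abs hi hp).trans ?_⟩
  rw [integral_const_mul]
  have : 0 ≤ c * (2 * s) ^ s := by positivity
  nlinarith [h.integral_le]

/-- On τ < b one has exp(b/2) ≤ exp(-τ/2) exp(b). At τ = 2 log(2n) the gain is 1/(2n), which keeps
the total clipping bias bounded. -/
lemma ExpMoment.tail_moment {b : Ω → ℝ} (h : ExpMoment μ b) {g : Ω → ℝ} (hg : Measurable g)
    {c s τ : ℝ} (hc : 0 ≤ c) (hs : 0 < s)
    (hle : ∀ ω, |g ω| ≤ if τ < b ω then c * b ω ^ s else 0) :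
    Integrable g μ ∧ ∫ ω, |g ω| ∂μ ≤ 2 * c * (2 * s) ^ s * Real.exp (-(τ / 2)) := by
  have hp : ∀ ω, |g ω| ≤ c * (2 * s) ^ s * Real.exp (-(τ / 2)) * Real.exp (b ω) := fun ω => by
    refine (hle ω).trans ?_
    split_ifs with hτ
    · rw [mul_assoc, mul_assoc]
      gcongr
      refine (rpow_le_exp_half (h.nonneg ω) hs).trans ?_
      gcongr
      rw [← Real.exp_add]
      exact Real.exp_le_exp.2 (by linarith)
    · positivity
  have hi := h.integrable.const_mul (c * (2 * s) ^ s * Real.exp (-(τ / 2)))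
  have hi' : Integrable g μ := hi.mono' hg.aestronglyMeasurable (Filter.Eventually.of_forall hp)
  refine ⟨hi', (integral_mono hi'.abs hi hp).trans ?_⟩
  rw [integral_const_mul]
  have : 0 ≤ c * (2 * s) ^ s * Real.exp (-(τ / 2)) := by positivity
  nlinarith [h.integral_le]

end Moments

/-! ### Tails of sums: excesses over a logarithmic level, and Bernstein's inequality. -/

section Tails

variable {Ω : Type*} [MeasurableSpace Ω] {μ : Measure Ω} [IsProbabilityMeasure μ] {n : ℕ}

/-- The excesses of independent variables over a level `2 log (2n)` have a sum of constant order. -/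
lemma measure_sum_excess_le {b : Fin n → Ω → ℝ} (hn : 1 ≤ n) (hind : iIndepFun b μ)
    (hb : ∀ i, ExpMoment μ (b i)) (t : ℝ) :
    μ.real {ω | 2 * (t + 1) ≤
      ∑ i, (if 2 * Real.log (2 * n) < b i ω then b i ω else 0)} ≤ Real.exp (-t) := by
  have hn0 : (0 : ℝ) < n := by exact_mod_cast hn
  set τ := 2 * Real.log (2 * n) with hτ
  let φ : ℝ → ℝ := fun x => if τ < x then x else 0
  have hφ : Measurable φ :=
    Measurable.ite (measurableSet_lt measurable_const measurable_id) measurable_id measurable_const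
  let G : Fin n → Ω → ℝ := fun i ω => φ (b i ω)
  have hGind : iIndepFun G μ := hind.comp (fun _ => φ) (fun _ => hφ)
  have hGm : ∀ i, Measurable (G i) := fun i => hφ.comp (hb i).meas
  have hexpτ : Real.exp (-(τ / 2)) = 1 / (2 * n) := by
    rw [hτ, mul_div_cancel_left₀ _ two_ne_zero, Real.exp_neg, Real.exp_log (by positivity), one_div]
  -- Below the level the exponential is 1; above it exp(b/2) ≤ exp(-τ/2) exp(b). So each mgf at 1/2
  -- is at most 1 + 1/n, and the product of n of them is at most e.
  have hp : ∀ i ω, Real.exp (1 / 2 * G i ω) ≤ 1 + 1 / (2 * n) * Real.exp (b i ω) := by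
    intro i ω
    simp only [G, φ]
    split_ifs with h
    · rw [← hexpτ, ← Real.exp_add]
      have := Real.exp_le_exp.2 (show 1 / 2 * b i ω ≤ -(τ / 2) + b i ω by linarith)
      linarith
    · simp; positivity
  have hi : ∀ i, Integrable (fun ω => 1 + 1 / (2 * n) * Real.exp (b i ω)) μ := fun i =>
    (integrable_const _).add ((hb i).integrable.const_mul _)
  have hi' : ∀ i, Integrable (fun ω => Real.exp (1 / 2 * G i ω)) μ := fun i =>
    (hi i).mono' ((hGm i).const_mul _).exp.aestronglyMeasurable
      (Filter.Eventually.of_forall fun ω => by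
        simpa [abs_of_pos (Real.exp_pos _)] using hp i ω)
  have hmgf : ∀ i, mgf (G i) μ (1 / 2) ≤ Real.exp (1 / n) := by
    intro i
    refine (integral_mono (hi' i) (hi i) (hp i)).trans ?_
    rw [integral_add (integrable_const _) ((hb i).integrable.const_mul _), integral_const_mul]
    have h1 : 1 / (2 * (n : ℝ)) * ∫ ω, Real.exp (b i ω) ∂μ ≤ 1 / (2 * n) * 2 := by
      gcongr; exact (hb i).integral_le
    have h2 : 1 / (2 * (n : ℝ)) * 2 = 1 / n := by field_simp
    simp only [integral_const, probReal_univ, smul_eq_mul, mul_one]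
    linarith [Real.add_one_le_exp (1 / (n : ℝ))]
  have hch := measure_ge_le_exp_mul_mgf (μ := μ) (X := ∑ i, G i) (t := 1 / 2) (2 * (t + 1))
    (by norm_num) (hGind.integrable_exp_mul_sum hGm fun i _ => hi' i)
  rw [hGind.mgf_sum hGm] at hch
  have hprod : ∏ i, mgf (G i) μ (1 / 2) ≤ Real.exp 1 := by
    calc ∏ i, mgf (G i) μ (1 / 2) ≤ ∏ _i : Fin n, Real.exp (1 / n) :=
          Finset.prod_le_prod (fun i _ => mgf_nonneg) fun i _ => hmgf i
      _ = Real.exp 1 := by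
          rw [Finset.prod_const, Finset.card_univ, Fintype.card_fin, ← Real.exp_nat_mul]
          congr 1
          field_simp
  have hset : {ω | 2 * (t + 1) ≤ ∑ i, (if τ < b i ω then b i ω else 0)} =
      {ω | 2 * (t + 1) ≤ (∑ i, G i) ω} := by
    ext ω; simp [G, φ]
  rw [hset]
  refine hch.trans ?_
  calc Real.exp (-(1 / 2) * (2 * (t + 1))) * ∏ i, mgf (G i) μ (1 / 2)
      ≤ Real.exp (-(1 / 2) * (2 * (t + 1))) * Real.exp 1 := by gcongr
    _ = Real.exp (-t) := by rw [← Real.exp_add]; ring_nf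

/-- Subadditivity of x ↦ x^q for q ≤ 1. It passes from a sum of powers with exponential moments to
the sum of the heavier-tailed variables themselves. -/
lemma sum_le_rpow_sum_rpow {ι : Type*} (s : Finset ι) {a : ι → ℝ} (ha : ∀ i, 0 ≤ a i) {q : ℝ}
    (hq : 0 < q) (hq1 : q ≤ 1) : ∑ i ∈ s, a i ≤ (∑ i ∈ s, a i ^ q) ^ (1 / q) := by
  have key : (∑ i ∈ s, a i) ^ q ≤ ∑ i ∈ s, a i ^ q := by
    classical
    induction s using Finset.induction_on with
    | empty => simp [hq.ne']
    | insert i s hi ih =>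
      rw [Finset.sum_insert hi, Finset.sum_insert hi]
      refine (Real.rpow_add_le_add_rpow (ha i) (Finset.sum_nonneg fun j _ => ha j)
        hq.le hq1).trans ?_
      linarith
  have h0 : 0 ≤ ∑ i ∈ s, a i := Finset.sum_nonneg fun j _ => ha j
  calc ∑ i ∈ s, a i = ((∑ i ∈ s, a i) ^ q) ^ (1 / q) := by
        rw [← Real.rpow_mul h0, mul_one_div_cancel hq.ne', Real.rpow_one]
    _ ≤ _ := Real.rpow_le_rpow (by positivity) key (by positivity)

/-- The upper tail in Bernstein's inequality. -/
lemma bernstein_upper {Z : Fin n → Ω → ℝ} (hind : iIndepFun Z μ) (hm : ∀ i, Measurable (Z i))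
    {M V t : ℝ} (hM : 0 < M) (hV0 : 0 < V) (ht : 0 ≤ t) (hb : ∀ i ω, |Z i ω| ≤ M)
    (hV : ∑ i, variance (Z i) μ ≤ V) :
    μ.real {ω | 2 * √(V * t) + 4 * M * t ≤ ∑ i, (Z i ω - ∫ ω', Z i ω' ∂μ)} ≤ Real.exp (-t) := by
  have hmean : ∀ i, |∫ ω', Z i ω' ∂μ| ≤ M := fun i => by
    have := norm_integral_le_of_norm_le_const (μ := μ) (f := Z i) (C := M)
      (Filter.Eventually.of_forall (hb i))
    simpa using this
  let W : Fin n → Ω → ℝ := fun i ω => Z i ω - ∫ ω', Z i ω' ∂μ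
  have hWind : iIndepFun W μ :=
    hind.comp (fun i x => x - ∫ ω', Z i ω' ∂μ) (fun i => measurable_id.sub_const _)
  have hWm : ∀ i, Measurable (W i) := fun i => (hm i).sub_const _
  have hWb : ∀ i ω, |W i ω| ≤ 2 * M := fun i ω => by
    have := abs_sub (Z i ω) (∫ ω', Z i ω' ∂μ)
    linarith [hb i ω, hmean i]
  have hZi : ∀ i, Integrable (Z i) μ := fun i =>
    Integrable.of_bound (hm i).aestronglyMeasurable M (Filter.Eventually.of_forall (hb i))
  have hWi : ∀ i, Integrable (W i) μ := fun i => (hZi i).sub (integrable_const _)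
  have hW2i : ∀ i, Integrable (fun ω => W i ω ^ 2) μ := fun i =>
    Integrable.of_bound ((hWm i).pow_const 2).aestronglyMeasurable ((2 * M) ^ 2)
      (Filter.Eventually.of_forall fun ω => by
        rw [Real.norm_eq_abs, abs_pow]; gcongr; exact hWb i ω)
  have hW0 : ∀ i, ∫ ω, W i ω ∂μ = 0 := fun i => by
    simp only [W]
    rw [integral_sub (hZi i) (integrable_const _)]
    simp
  have hWv : ∀ i, ∫ ω, W i ω ^ 2 ∂μ = variance (Z i) μ := fun i =>
    (variance_eq_integral (hm i).aemeasurable).symm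
  have hexpi : ∀ s i, 0 ≤ s → Integrable (fun ω => Real.exp (s * W i ω)) μ := fun s i hs =>
    Integrable.of_bound ((hWm i).const_mul s).exp.aestronglyMeasurable (Real.exp (s * (2 * M)))
      (Filter.Eventually.of_forall fun ω => by
        rw [Real.norm_eq_abs, abs_of_pos (Real.exp_pos _)]
        exact Real.exp_le_exp.2 (by gcongr; exact (le_abs_self _).trans (hWb i ω)))
  have main : ∀ s, 0 ≤ s → s * (2 * M) ≤ 1 →
      μ.real {ω | 2 * √(V * t) + 4 * M * t ≤ ∑ i, W i ω} ≤
        Real.exp (-s * (2 * √(V * t) + 4 * M * t) + s ^ 2 * V) := by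
    intro s hs hsM
    have hmgf : ∀ i, mgf (W i) μ s ≤ Real.exp (s ^ 2 * variance (Z i) μ) := by
      intro i
      -- exp y ≤ 1 + y + y² for |y| ≤ 1; the quadratic term brings in the variance.
      have hpt : ∀ ω, Real.exp (s * W i ω) ≤ 1 + s * W i ω + s ^ 2 * W i ω ^ 2 := fun ω => by
        have h1 : |s * W i ω| ≤ 1 := by
          rw [abs_mul, abs_of_nonneg hs]
          exact (mul_le_mul_of_nonneg_left (hWb i ω) hs).trans hsM
        have := (abs_le.1 (Real.abs_exp_sub_one_sub_id_le h1)).2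
        nlinarith
      have hint1 : Integrable (fun ω => 1 + s * W i ω) μ :=
        (integrable_const _).add ((hWi i).const_mul _)
      have hint : Integrable (fun ω => 1 + s * W i ω + s ^ 2 * W i ω ^ 2) μ :=
        hint1.add ((hW2i i).const_mul _)
      refine (integral_mono (hexpi s i hs) hint hpt).trans ?_
      rw [integral_add hint1 ((hW2i i).const_mul _),
        integral_add (integrable_const _) ((hWi i).const_mul _), integral_const_mul,
        integral_const_mul, hW0, hWv]
      simp only [integral_const, probReal_univ, smul_eq_mul, mul_one, mul_zero, add_zero]
      linarith [Real.add_one_le_exp (s ^ 2 * variance (Z i) μ)]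
    have hch := measure_ge_le_exp_mul_mgf (μ := μ) (X := ∑ i, W i) (t := s)
      (2 * √(V * t) + 4 * M * t) hs (hWind.integrable_exp_mul_sum hWm fun i _ => hexpi s i hs)
    rw [hWind.mgf_sum hWm] at hch
    have hset : {ω | 2 * √(V * t) + 4 * M * t ≤ ∑ i, W i ω} =
        {ω | 2 * √(V * t) + 4 * M * t ≤ (∑ i, W i) ω} := by
      ext ω; simp
    rw [hset]
    refine hch.trans ?_
    rw [Real.exp_add]
    gcongr
    calc ∏ i, mgf (W i) μ s ≤ ∏ i, Real.exp (s ^ 2 * variance (Z i) μ) :=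
          Finset.prod_le_prod (fun i _ => mgf_nonneg) fun i _ => hmgf i
      _ = Real.exp (s ^ 2 * ∑ i, variance (Z i) μ) := by
          rw [← Real.exp_sum, Finset.mul_sum]
      _ ≤ _ := by gcongr
  set q := √(V * t) with hq
  have hq2 : q ^ 2 = V * t := Real.sq_sqrt (by positivity)
  have hq0 : 0 ≤ q := Real.sqrt_nonneg _
  -- Ignoring the term 4Mt, the best s is √(Vt)/V. If it exceeds the admissible range, the endpoint
  -- s = 1/(2M) satisfies sV ≤ √(Vt), and the linear term 4Mt pays for t.
  by_cases hc : q / V * (2 * M) ≤ 1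
  · refine (main (q / V) (by positivity) hc).trans (Real.exp_le_exp.2 ?_)
    have e1 : (q / V) ^ 2 * V = t := by
      rw [div_pow, hq2]; field_simp
    have e2 : q / V * q = t := by
      rw [div_mul_eq_mul_div, ← sq, hq2]; field_simp
    have e3 : 0 ≤ q / V * (4 * M * t) := by positivity
    nlinarith
  · push Not at hc
    have hs1 : 1 / (2 * M) * (2 * M) = 1 := by field_simp
    refine (main (1 / (2 * M)) (by positivity) hs1.le).trans (Real.exp_le_exp.2 ?_)
    set s := 1 / (2 * M) with hs
    have hs0 : 0 < s := by positivity
    have hsq : s * V ≤ q := by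
      have : s < q / V := by
        rw [hs, div_lt_iff₀ (by positivity)]; exact hc
      rw [lt_div_iff₀ hV0] at this
      exact this.le
    have e1 : s ^ 2 * V ≤ s * q := by nlinarith
    have e2 : s * (4 * M * t) = 2 * t := by
      calc s * (4 * M * t) = s * (2 * M) * (2 * t) := by ring
        _ = _ := by rw [hs1, one_mul]
    nlinarith [mul_nonneg hs0.le hq0]

/-- Bernstein's inequality. -/
lemma bernstein {Z : Fin n → Ω → ℝ} (hind : iIndepFun Z μ) (hm : ∀ i, Measurable (Z i))
    {M V t : ℝ} (hM : 0 < M) (hV0 : 0 < V) (ht : 0 ≤ t) (hb : ∀ i ω, |Z i ω| ≤ M)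
    (hV : ∑ i, variance (Z i) μ ≤ V) :
    μ.real {ω | 2 * √(V * t) + 4 * M * t ≤ |∑ i, (Z i ω - ∫ ω', Z i ω' ∂μ)|} ≤
      2 * Real.exp (-t) := by
  have h1 := bernstein_upper hind hm hM hV0 ht hb hV
  have h2 := bernstein_upper (Z := fun i ω => -Z i ω)
    (hind.comp (fun _ x => -x) (fun _ => measurable_neg)) (fun i => (hm i).neg) hM hV0 ht
    (fun i ω => by simpa using hb i ω) (by simpa [variance_fun_neg] using hV)
  have hsub : {ω | 2 * √(V * t) + 4 * M * t ≤ |∑ i, (Z i ω - ∫ ω', Z i ω' ∂μ)|} ⊆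
      {ω | 2 * √(V * t) + 4 * M * t ≤ ∑ i, (Z i ω - ∫ ω', Z i ω' ∂μ)} ∪
      {ω | 2 * √(V * t) + 4 * M * t ≤ ∑ i, (-Z i ω - ∫ ω', -Z i ω' ∂μ)} := by
    intro ω hω
    have hω' : 2 * √(V * t) + 4 * M * t ≤ |∑ i, (Z i ω - ∫ ω', Z i ω' ∂μ)| := hω
    rcases le_abs.1 hω' with h | h
    · exact Or.inl h
    · refine Or.inr ?_
      have : ∑ i, (-Z i ω - ∫ ω', -Z i ω' ∂μ) = -∑ i, (Z i ω - ∫ ω', Z i ω' ∂μ) := by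
        rw [← Finset.sum_neg_distrib]
        refine Finset.sum_congr rfl fun i _ => ?_
        rw [integral_neg]; ring
      change _ ≤ ∑ i, (-Z i ω - ∫ ω', -Z i ω' ∂μ)
      rw [this]; exact h
  refine (measureReal_mono hsub).trans ((measureReal_union_le _ _).trans ?_)
  linarith

end Tails

/-! ### Clipping and its errors. -/

section Clip

variable {Ω : Type*} [MeasurableSpace Ω] {μ : Measure Ω}

/-- Clipping of `x` at the levels `-M` and `M`. -/
noncomputable def clip (M x : ℝ) : ℝ := max (-M) (min x M)

lemma measurable_clip (M : ℝ) : Measurable (clip M) := by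
  unfold clip; fun_prop

lemma abs_clip_le {M : ℝ} (hM : 0 ≤ M) (x : ℝ) : |clip M x| ≤ M := by
  unfold clip
  rw [abs_le]
  exact ⟨le_max_left _ _, max_le (by linarith) (min_le_right _ _)⟩

lemma clip_eq_self {M x : ℝ} (h : |x| ≤ M) : clip M x = x := by
  unfold clip
  rw [abs_le] at h
  rw [min_eq_left h.2, max_eq_right h.1]

lemma abs_clip_sub_clip_le (M x y : ℝ) : |clip M x - clip M y| ≤ |x - y| := by
  unfold clip
  refine (abs_max_sub_max_le_max _ _ _ _).trans ?_
  rw [sub_self, abs_zero, max_eq_right (abs_nonneg _)]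
  refine (abs_min_sub_min_le_max _ _ _ _).trans ?_
  rw [sub_self, abs_zero, max_eq_left (abs_nonneg _)]

lemma abs_sub_clip_le {M : ℝ} (hM : 0 ≤ M) (x : ℝ) :
    |x - clip M x| ≤ if M < |x| then |x| else 0 := by
  split_ifs with h
  · unfold clip
    rcases le_total 0 x with hx | hx
    · rw [abs_of_nonneg hx] at h ⊢
      rw [min_eq_right h.le, max_eq_right (by linarith), abs_of_nonneg (by linarith)]
      linarith
    · rw [abs_of_nonpos hx] at h ⊢
      rw [min_eq_left (by linarith), max_eq_left (by linarith), abs_of_nonpos (by linarith)]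
      linarith
  · rw [clip_eq_self (not_lt.1 h)]; simp

/-- `x²` where `|x|` exceeds `M`. -/
noncomputable def sqTail (M x : ℝ) : ℝ := if M < |x| then x ^ 2 else 0

lemma sqTail_nonneg (M x : ℝ) : 0 ≤ sqTail M x := by
  unfold sqTail; split_ifs <;> positivity

lemma measurable_sqTail (M : ℝ) : Measurable (sqTail M) :=
  Measurable.ite (measurableSet_lt measurable_const measurable_norm)
    (measurable_id.pow_const 2) measurable_const

lemma exists_clip_eq_mul {M : ℝ} (hM : 0 ≤ M) (x : ℝ) :
    ∃ s : ℝ, 0 ≤ s ∧ s ≤ 1 ∧ clip M x = s * x := by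
  by_cases h : |x| ≤ M
  · exact ⟨1, zero_le_one, le_rfl, by rw [clip_eq_self h, one_mul]⟩
  · push Not at h
    have hx : 0 < |x| := hM.trans_lt h
    refine ⟨M / |x|, by positivity, (div_le_one hx).2 h.le, ?_⟩
    unfold clip
    rcases le_total 0 x with h0 | h0
    · rw [abs_of_nonneg h0] at h hx ⊢
      rw [min_eq_right h.le, max_eq_right (by linarith)]
      field_simp
    · rw [abs_of_nonpos h0] at h hx ⊢
      rw [min_eq_left (by linarith), max_eq_left (by linarith)]
      have : x ≠ 0 := by linarith
      field_simp

/-- If a clip is active, the factor of larger absolute value exceeds M and its square bounds the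
product. Thus p coordinatewise tail sums control all p² entries of a Gram matrix. -/
lemma abs_mul_sub_clip_mul_clip_le {M : ℝ} (hM : 0 ≤ M) (x y : ℝ) :
    |x * y - clip M x * clip M y| ≤ sqTail M x + sqTail M y := by
  by_cases h : |x| ≤ M ∧ |y| ≤ M
  · rw [clip_eq_self h.1, clip_eq_self h.2]
    simpa using add_nonneg (sqTail_nonneg M x) (sqTail_nonneg M y)
  · obtain ⟨s, hs0, hs1, hs⟩ := exists_clip_eq_mul hM x
    obtain ⟨r, hr0, hr1, hr⟩ := exists_clip_eq_mul hM y
    have h1 : |x * y - clip M x * clip M y| ≤ |x| * |y| := by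
      rw [hs, hr, show x * y - s * x * (r * y) = (1 - s * r) * (x * y) by ring, abs_mul, abs_mul]
      have hsr : s * r ≤ 1 := mul_le_one₀ hs1 hr0 hr1
      rw [abs_of_nonneg (by linarith)]
      exact mul_le_of_le_one_left (by positivity) (by linarith [mul_nonneg hs0 hr0])
    refine h1.trans ?_
    rcases le_total |x| |y| with hxy | hxy
    · have hy : M < |y| := by
        by_contra hc
        exact h ⟨hxy.trans (not_lt.1 hc), not_lt.1 hc⟩
      have : sqTail M y = |y| ^ 2 := by rw [sqTail, if_pos hy, sq_abs]
      nlinarith [sqTail_nonneg M x, abs_nonneg x, abs_nonneg y]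
    · have hy : M < |x| := by
        by_contra hc
        exact h ⟨not_lt.1 hc, hxy.trans (not_lt.1 hc)⟩
      have : sqTail M x = |x| ^ 2 := by rw [sqTail, if_pos hy, sq_abs]
      nlinarith [sqTail_nonneg M y, abs_nonneg x, abs_nonneg y]

/-- The variance is at most the second moment about any constant; take the clipped mean of f and use
that clipping is 1-Lipschitz. -/
lemma variance_clip_le [IsProbabilityMeasure μ] {f : Ω → ℝ} (hf : Measurable f)
    (hf2 : MemLp f 2 μ) (M : ℝ) :
    variance (fun ω => clip M (f ω)) μ ≤ variance f μ := by
  have hc : Measurable (fun ω => clip M (f ω)) := (measurable_clip M).comp hf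
  set c := clip M (∫ ω, f ω ∂μ)
  have hm : Measurable (fun ω => clip M (f ω) - c) := hc.sub_const _
  calc variance (fun ω => clip M (f ω)) μ = variance (fun ω => clip M (f ω) - c) μ :=
        (variance_sub_const hc.aestronglyMeasurable c).symm
    _ ≤ ∫ ω, (clip M (f ω) - c) ^ 2 ∂μ :=
        variance_le_expectation_sq hm.aestronglyMeasurable
    _ ≤ ∫ ω, (f ω - ∫ ω', f ω' ∂μ) ^ 2 ∂μ := by
        have hi : Integrable (fun ω => (f ω - ∫ ω', f ω' ∂μ) ^ 2) μ :=
          (hf2.sub (memLp_const _)).integrable_sq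
        have hle : ∀ ω, (clip M (f ω) - c) ^ 2 ≤ (f ω - ∫ ω', f ω' ∂μ) ^ 2 := fun ω =>
          sq_le_sq.2 (abs_clip_sub_clip_le _ _ _)
        refine integral_mono (hi.mono' (hm.pow_const 2).aestronglyMeasurable
          (Filter.Eventually.of_forall fun ω => ?_)) hi hle
        rw [Real.norm_eq_abs, abs_of_nonneg (sq_nonneg _)]
        exact hle ω
    _ = variance f μ := (variance_eq_integral hf.aemeasurable).symm

end Clip

end SubWeibullLasso

namespace SubWeibullLasso

/-! ### Quadratic forms on ℓ₁ balls and finite families of certificates. -/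

section QuadraticForms

open Matrix

variable {p : ℕ}

lemma abs_dotProduct_le (θ v : Fin p → ℝ) {c : ℝ} (hv : ∀ j, |v j| ≤ c) :
    |θ ⬝ᵥ v| ≤ (∑ j, |θ j|) * c := by
  rw [dotProduct, Finset.sum_mul]
  refine (Finset.abs_sum_le_sum_abs _ _).trans (Finset.sum_le_sum fun j _ => ?_)
  rw [abs_mul]
  gcongr
  exact hv j

lemma abs_quadratic_sub_le (A B : Matrix (Fin p) (Fin p) ℝ) (θ : Fin p → ℝ) {c : ℝ}
    (h : ∀ a b, |A a b - B a b| ≤ c) :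
    |θ ⬝ᵥ A *ᵥ θ - θ ⬝ᵥ B *ᵥ θ| ≤ (∑ j, |θ j|) ^ 2 * c := by
  rw [← dotProduct_sub, ← sub_mulVec, sq, mul_assoc]
  refine abs_dotProduct_le _ _ fun j => ?_
  rw [mulVec, dotProduct_comm]
  exact abs_dotProduct_le _ _ fun b => by simpa using h j b

/-- Expand (δ - η)'A(δ - η) ≥ 0. The lower bound is linear in δ, so for fixed η it is controlled
over the whole ℓ₁ ball by the single vector Aη. -/
lemma PosSemidef.two_mul_sub_le {A : Matrix (Fin p) (Fin p) ℝ} (hA : A.PosSemidef)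
    (δ η : Fin p → ℝ) : 2 * (δ ⬝ᵥ A *ᵥ η) - η ⬝ᵥ A *ᵥ η ≤ δ ⬝ᵥ A *ᵥ δ := by
  have h := hA.dotProduct_mulVec_nonneg (δ - η)
  have hs : η ⬝ᵥ A *ᵥ δ = δ ⬝ᵥ A *ᵥ η := by
    have : Aᵀ = A := by simpa using hA.isHermitian.eq
    rw [dotProduct_mulVec, ← mulVec_transpose, this, dotProduct_comm]
  simp only [star_trivial, mulVec_sub, dotProduct_sub, sub_dotProduct] at h
  linarith

/-- Stability of the lower bound `A = η'Sη` under a perturbation of `S` that is small along `η`. -/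
lemma quadratic_lower_bound {S T : Matrix (Fin p) (Fin p) ℝ} (hT : T.PosSemidef)
    {δ η : Fin p → ℝ} {R d : ℝ} (hδ : ∑ j, |δ j| ≤ R) (hη : ∑ j, |η j| ≤ R)
    (hd0 : 0 ≤ d) (hd : ∀ j, |(T *ᵥ η) j - (S *ᵥ η) j| ≤ d)
    (hδη : η ⬝ᵥ S *ᵥ η ≤ δ ⬝ᵥ S *ᵥ η) :
    η ⬝ᵥ S *ᵥ η - 3 * (R * d) ≤ δ ⬝ᵥ T *ᵥ δ := by
  have key : ∀ θ : Fin p → ℝ, ∑ j, |θ j| ≤ R → |θ ⬝ᵥ T *ᵥ η - θ ⬝ᵥ S *ᵥ η| ≤ R * d := by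
    intro θ hθ
    rw [← dotProduct_sub]
    refine (abs_dotProduct_le θ _ (c := d) fun j => by simpa using hd j).trans ?_
    gcongr
  have h1 := (abs_le.1 (key δ hδ)).1
  have h2 := (abs_le.1 (key η hη)).2
  -- The error of δ'Tη counts twice and that of η'Tη once, whence the factor 3.
  linarith [PosSemidef.two_mul_sub_le hT δ η]

/-- Existence of a minimizer of a quadratic form over a slice of the `ℓ₁` ball, with its
first-order condition. -/
lemma exists_slice_minimizer {S : Matrix (Fin p) (Fin p) ℝ} (hS : S.PosSemidef)
    (u : Fin p → ℝ) (R c : ℝ) (hne : ∃ θ : Fin p → ℝ, ∑ j, |θ j| ≤ R ∧ c ≤ u ⬝ᵥ θ) :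
    ∃ η : Fin p → ℝ, (∑ j, |η j| ≤ R ∧ c ≤ u ⬝ᵥ η) ∧
      ∀ δ : Fin p → ℝ, ∑ j, |δ j| ≤ R → c ≤ u ⬝ᵥ δ → η ⬝ᵥ S *ᵥ η ≤ δ ⬝ᵥ S *ᵥ η := by
  let G : Set (Fin p → ℝ) := {θ | ∑ j, |θ j| ≤ R ∧ c ≤ u ⬝ᵥ θ}
  have hcl : IsClosed G := by
    have h1 : IsClosed {θ : Fin p → ℝ | ∑ j, |θ j| ≤ R} :=
      isClosed_le (by fun_prop) continuous_const
    have h2 : IsClosed {θ : Fin p → ℝ | c ≤ u ⬝ᵥ θ} :=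
      isClosed_le continuous_const (by unfold dotProduct; fun_prop)
    exact h1.inter h2
  have hbd : Bornology.IsBounded G := by
    refine (Metric.isBounded_iff_subset_closedBall 0).2 ⟨R, fun θ hθ => ?_⟩
    have h0 : 0 ≤ R := (Finset.sum_nonneg fun j _ => abs_nonneg (θ j)).trans hθ.1
    rw [mem_closedBall_zero_iff, pi_norm_le_iff_of_nonneg h0]
    exact fun j => (Finset.single_le_sum (f := fun j => |θ j|)
      (fun j _ => abs_nonneg (θ j)) (Finset.mem_univ j)).trans hθ.1
  have hcpt : IsCompact G := Metric.isCompact_of_isClosed_isBounded hcl hbd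
  have hcont : Continuous fun θ : Fin p → ℝ => θ ⬝ᵥ S *ᵥ θ := by
    unfold mulVec dotProduct; fun_prop
  obtain ⟨η, hηG, hη⟩ := hcpt.exists_isMinOn hne hcont.continuousOn
  refine ⟨η, hηG, fun δ hδ1 hδ2 => ?_⟩
  by_contra hlt
  push Not at hlt
  have hsym : ∀ a b : Fin p → ℝ, a ⬝ᵥ S *ᵥ b = b ⬝ᵥ S *ᵥ a := fun a b => by
    have : Sᵀ = S := by simpa using hS.isHermitian.eq
    rw [dotProduct_mulVec, ← mulVec_transpose, this, dotProduct_comm]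
  set g := η ⬝ᵥ S *ᵥ η - δ ⬝ᵥ S *ᵥ η with hg
  have hg0 : 0 < g := by linarith
  set q := (δ - η) ⬝ᵥ S *ᵥ (δ - η) with hq
  have hq0 : 0 ≤ q := by
    have := hS.dotProduct_mulVec_nonneg (δ - η)
    rwa [star_trivial] at this
  have hmem : ∀ s : ℝ, 0 ≤ s → s ≤ 1 → η + s • (δ - η) ∈ G := by
    intro s hs0 hs1
    constructor
    · calc ∑ j, |(η + s • (δ - η)) j| ≤ ∑ j, ((1 - s) * |η j| + s * |δ j|) := by
            refine Finset.sum_le_sum fun j _ => ?_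
            have : (η + s • (δ - η)) j = (1 - s) * η j + s * δ j := by
              simp only [Pi.add_apply, Pi.smul_apply, Pi.sub_apply, smul_eq_mul]; ring
            rw [this]
            refine (abs_add_le _ _).trans ?_
            rw [abs_mul, abs_mul, abs_of_nonneg hs0, abs_of_nonneg (by linarith : 0 ≤ 1 - s)]
        _ ≤ (1 - s) * R + s * R := by
            rw [Finset.sum_add_distrib, ← Finset.mul_sum, ← Finset.mul_sum]
            have := hηG.1
            gcongr
        _ = R := by ring
    · have h1 := hηG.2
      rw [dotProduct_add, dotProduct_smul, dotProduct_sub, smul_eq_mul]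
      nlinarith
  have hexp : ∀ s : ℝ, (η + s • (δ - η)) ⬝ᵥ S *ᵥ (η + s • (δ - η)) =
      η ⬝ᵥ S *ᵥ η - 2 * s * g + s ^ 2 * q := by
    intro s
    have e : (δ - η) ⬝ᵥ S *ᵥ η = -g := by rw [sub_dotProduct, hg]; ring
    rw [mulVec_add, dotProduct_add, add_dotProduct, add_dotProduct, mulVec_smul, dotProduct_smul,
      dotProduct_smul, smul_dotProduct, smul_dotProduct, hsym η (δ - η), e, ← hq]
    simp only [smul_eq_mul]
    ring
  -- A step s from η towards δ changes the form by -2sg + s²q. This s lies in (0, 1] even if q = 0,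
  -- and sq ≤ g makes the change at most -sg < 0, against minimality.
  have hs : 0 < g / (g + q) := by positivity
  have hs1 : g / (g + q) ≤ 1 := (div_le_one (by positivity)).2 (by linarith)
  have hmin := hη (hmem _ hs.le hs1)
  simp only [Set.mem_ofPred_eq, hexp] at hmin
  have hsq : g / (g + q) * q ≤ g := by
    rw [div_mul_eq_mul_div, div_le_iff₀ (by positivity)]; nlinarith
  nlinarith [mul_pos hs hg0]

/-- An integer vector of ℓ₁ norm at most m is a sum of m terms, each zero or a signed unit vector:
2p + 1 choices per term. -/
lemma exists_int_net (p m : ℕ) : ∃ N : Finset (Fin p → ℤ), N.card ≤ (2 * p + 1) ^ m ∧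
    ∀ z : Fin p → ℤ, ∑ j, |z j| ≤ m → z ∈ N := by
  classical
  induction m with
  | zero =>
    refine ⟨{0}, by simp, fun z hz => ?_⟩
    rw [Finset.mem_singleton]
    ext j
    have h := (Finset.sum_eq_zero_iff_of_nonneg fun j _ => abs_nonneg (z j)).1
      (le_antisymm (by simpa using hz) (Finset.sum_nonneg fun j _ => abs_nonneg (z j)))
    simpa using h j (Finset.mem_univ j)
  | succ m ih =>
    obtain ⟨N, hN, hmem⟩ := ih
    let g : Option (Fin p × Bool) → (Fin p → ℤ) := fun o =>
      o.elim 0 (fun a => Pi.single a.1 (if a.2 then 1 else -1))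
    refine ⟨Finset.image₂ (fun z o => z + g o) N Finset.univ, ?_, fun z hz => ?_⟩
    · refine (Finset.card_image₂_le _ _ _).trans ?_
      rw [pow_succ]
      refine Nat.mul_le_mul hN ?_
      simp [Finset.card_univ, mul_comm]
    · rw [Finset.mem_image₂]
      by_cases h0 : ∀ j, z j = 0
      · refine ⟨z, hmem z ?_, none, Finset.mem_univ _, by simp [g]⟩
        simp [h0]
      · push Not at h0
        obtain ⟨j, hj⟩ := h0
        let b : Bool := decide (0 < z j)
        refine ⟨z - g (some (j, b)), hmem _ ?_, some (j, b), Finset.mem_univ _, by simp⟩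
        have h1 : ∀ i, |(z - g (some (j, b))) i| = |z i| - (if i = j then 1 else 0) := by
          intro i
          by_cases hij : i = j
          · subst hij
            simp only [g, b, Option.elim, Pi.sub_apply, Pi.single_eq_same, if_true]
            rcases lt_or_gt_of_ne hj with h | h
            · simp only [not_lt.2 h.le, decide_false, Bool.false_eq_true, if_false]
              rw [abs_of_neg h, abs_of_nonpos (by omega)]; ring
            · simp only [h, decide_true, if_true]
              rw [abs_of_pos h, abs_of_nonneg (by omega)]
          · simp [g, hij]
        have h2 : ∑ i, |(z - g (some (j, b))) i| = ∑ i, |z i| - 1 := by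
          simp only [h1, Finset.sum_sub_distrib, Finset.sum_ite_eq', Finset.mem_univ, if_true]
        rw [h2]
        push_cast at hz
        linarith

/-- Rounding towards zero. -/
lemma exists_int_round (x : ℝ) {h : ℝ} (hh : 0 < h) :
    ∃ z : ℤ, h * |(z : ℝ)| ≤ |x| ∧ (|x| - h) * |x| ≤ h * z * x := by
  have key : ∀ y : ℝ, 0 ≤ y → ∃ z : ℤ, 0 ≤ z ∧ h * z ≤ y ∧ y - h ≤ h * z := by
    intro y hy
    refine ⟨⌊y / h⌋, Int.floor_nonneg.2 (by positivity), ?_, ?_⟩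
    · have := Int.floor_le (y / h)
      rw [le_div_iff₀ hh] at this
      linarith
    · have := Int.lt_floor_add_one (y / h)
      rw [div_lt_iff₀ hh] at this
      nlinarith
  obtain ⟨z, hz0, hz1, hz2⟩ := key |x| (abs_nonneg x)
  have hz0' : (0 : ℝ) ≤ z := by exact_mod_cast hz0
  rcases le_total 0 x with hx | hx
  · rw [abs_of_nonneg hx] at *
    exact ⟨z, by rwa [abs_of_nonneg hz0'], by nlinarith⟩
  · rw [abs_of_nonpos hx] at *
    refine ⟨-z, by push_cast; rwa [abs_neg, abs_of_nonneg hz0'], ?_⟩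
    push_cast
    nlinarith

/-- A finite family of vectors `η`, such that each unit vector `δ` with `‖δ‖₁ ≤ 4√k` satisfies
`η'Sη ≤ δ'Sη` for one of them. -/
lemma exists_certificates {S : Matrix (Fin p) (Fin p) ℝ} (hS : S.PosSemidef) {k : ℕ} (hk : 1 ≤ k)
    {r : ℝ} (hr : ∀ θ : Fin p → ℝ, ∑ j, |θ j| ≤ 4 * √k → 9 / 16 ≤ ∑ j, θ j ^ 2 →
      r ≤ θ ⬝ᵥ S *ᵥ θ) :
    ∃ H : Finset (Fin p → ℝ), H.card ≤ (2 * p + 1) ^ (64 * k) ∧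
      (∀ η ∈ H, ∑ j, |η j| ≤ 4 * √k ∧ r ≤ η ⬝ᵥ S *ᵥ η) ∧
      ∀ δ : Fin p → ℝ, ∑ j, |δ j| ≤ 4 * √k → ∑ j, δ j ^ 2 = 1 →
        ∃ η ∈ H, η ⬝ᵥ S *ᵥ η ≤ δ ⬝ᵥ S *ᵥ η := by
  classical
  have hk0 : (0 : ℝ) < k := by exact_mod_cast hk
  have hsk : 0 < √(k : ℝ) := Real.sqrt_pos.2 hk0
  have hsk2 : √(k : ℝ) * √k = k := Real.mul_self_sqrt hk0.le
  -- Chosen so that h · 4√k = 1/4: rounding loses at most 1/4 of u·δ, and the rounded integer vector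
  -- has ℓ₁ norm at most 4√k/h = 64k.
  set h : ℝ := 1 / (16 * √k) with hh
  have hh0 : 0 < h := by positivity
  obtain ⟨N, hN, hmem⟩ := exists_int_net p (64 * k)
  let u : (Fin p → ℤ) → Fin p → ℝ := fun z j => h * z j
  let P : (Fin p → ℤ) → (Fin p → ℝ) → Prop := fun z η =>
    (∑ j, |η j| ≤ 4 * √k ∧ 3 / 4 ≤ u z ⬝ᵥ η) ∧
      ∀ δ : Fin p → ℝ, ∑ j, |δ j| ≤ 4 * √k → 3 / 4 ≤ u z ⬝ᵥ δ → η ⬝ᵥ S *ᵥ η ≤ δ ⬝ᵥ S *ᵥ η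
  let f : (Fin p → ℤ) → Fin p → ℝ := fun z => if hz : ∃ η, P z η then hz.choose else 0
  have hf : ∀ z, (∃ η, P z η) → P z (f z) := fun z hz => by
    simp only [f, dif_pos hz]; exact hz.choose_spec
  refine ⟨(N.filter fun z => (∃ η, P z η) ∧ ∑ j, u z j ^ 2 ≤ 1).image f,
    (Finset.card_image_le.trans (Finset.card_filter_le _ _)).trans hN, ?_, ?_⟩
  · intro η hη
    obtain ⟨z, hz, rfl⟩ := Finset.mem_image.1 hη
    obtain ⟨-, hz1, hz2⟩ := Finset.mem_filter.1 hz
    obtain ⟨⟨h1, h2⟩, -⟩ := hf z hz1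
    refine ⟨h1, hr _ h1 ?_⟩
    -- With ‖u‖ ≤ 1 and u·η ≥ 3/4, Cauchy–Schwarz gives ‖η‖² ≥ 9/16, as `hr` requires.
    have hcs := Finset.sum_mul_sq_le_sq_mul_sq Finset.univ (u z) (f z)
    rw [dotProduct] at h2
    have hnn : 0 ≤ ∑ j, f z j ^ 2 := Finset.sum_nonneg fun j _ => sq_nonneg _
    nlinarith
  · intro δ hδ1 hδ2
    choose z hz1 hz2 using fun j => exists_int_round (δ j) hh0
    have hzN : z ∈ N := by
      refine hmem z ?_
      have : ∑ j, |(z j : ℝ)| ≤ ((64 * k : ℕ) : ℝ) := by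
        have h1 : h * ∑ j, |(z j : ℝ)| ≤ 4 * √k := by
          rw [Finset.mul_sum]
          exact (Finset.sum_le_sum fun j _ => hz1 j).trans hδ1
        rw [hh, div_mul_eq_mul_div, one_mul, div_le_iff₀ (by positivity)] at h1
        push_cast
        nlinarith
      exact_mod_cast this
    have hu1 : ∑ j, u z j ^ 2 ≤ 1 := by
      rw [← hδ2]
      refine Finset.sum_le_sum fun j _ => sq_le_sq.2 ?_
      simp only [u, abs_mul, abs_of_pos hh0]
      exact hz1 j
    have hu2 : 3 / 4 ≤ u z ⬝ᵥ δ := by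
      have h1 : ∑ j, (|δ j| - h) * |δ j| ≤ u z ⬝ᵥ δ := Finset.sum_le_sum fun j _ => hz2 j
      have h2 : ∑ j, (|δ j| - h) * |δ j| = 1 - h * ∑ j, |δ j| := by
        rw [← hδ2, Finset.mul_sum, ← Finset.sum_sub_distrib]
        refine Finset.sum_congr rfl fun j _ => ?_
        rw [sub_mul, ← sq, sq_abs]
      have h3 : h * ∑ j, |δ j| ≤ 1 / 4 := by
        calc h * ∑ j, |δ j| ≤ h * (4 * √k) := by gcongr
          _ = 1 / 4 := by rw [hh]; field_simp; norm_num
      linarith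
    have hex : ∃ η, P z η := exists_slice_minimizer hS (u z) _ _ ⟨δ, hδ1, hu2⟩
    exact ⟨f z, Finset.mem_image_of_mem f (Finset.mem_filter.2 ⟨hzN, hex, hu1⟩),
      (hf z hex).2 δ hδ1 hu2⟩

/-- The quadratic form of a symmetric matrix is at least its smallest eigenvalue. -/
lemma lambdaMin_mul_le {A : Matrix (Fin p) (Fin p) ℝ} (hA : A.IsHermitian) (θ : Fin p → ℝ) :
    lambdaMin A * ∑ j, θ j ^ 2 ≤ θ ⬝ᵥ A *ᵥ θ := by
  have hps : (A - algebraMap ℝ _ (lambdaMin A)).PosSemidef := by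
    rw [posSemidef_iff_isHermitian_and_spectrum_nonneg]
    refine ⟨hA.sub ?_, ?_⟩
    · rw [IsHermitian, conjTranspose_eq_transpose_of_trivial, algebraMap_eq_diagonal,
        diagonal_transpose]
    · intro x hx
      rw [← spectrum.sub_singleton_eq, Set.sub_singleton] at hx
      obtain ⟨y, hy, rfl⟩ := hx
      have : lambdaMin A ≤ y := by
        refine csInf_le ?_ hy
        rw [hA.spectrum_real_eq_range_eigenvalues]
        exact (Set.finite_range _).bddBelow
      simpa using this
  have h := hps.dotProduct_mulVec_nonneg θ
  have e : θ ⬝ᵥ (algebraMap ℝ (Matrix (Fin p) (Fin p) ℝ) (lambdaMin A)) *ᵥ θ =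
      lambdaMin A * ∑ j, θ j ^ 2 := by
    rw [Algebra.algebraMap_eq_smul_one, smul_mulVec, one_mulVec, dotProduct_smul, smul_eq_mul,
      dotProduct]
    simp only [sq]
  rw [star_trivial, sub_mulVec, dotProduct_sub, e] at h
  linarith

end QuadraticForms

/-! ### Deterministic analysis of the Lasso. -/

section Lasso

variable {n p : ℕ}

lemma inner_eq_sum (x θ : EuclideanSpace ℝ (Fin p)) : inner ℝ x θ = ∑ j, x j * θ j := by
  simp [PiLp.inner_apply, mul_comm]

lemma l1_nonneg (θ : EuclideanSpace ℝ (Fin p)) : 0 ≤ l1 θ :=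
  Finset.sum_nonneg fun _ _ => abs_nonneg _

lemma norm_le_l1 (θ : EuclideanSpace ℝ (Fin p)) : ‖θ‖ ≤ l1 θ := by
  rw [EuclideanSpace.norm_eq, Real.sqrt_le_left (l1_nonneg θ)]
  unfold l1
  simpa using Finset.sum_sq_le_sq_sum_of_nonneg (s := Finset.univ) (f := fun j => |θ j|)
    fun j _ => abs_nonneg _

lemma exists_isLasso (x : Fin n → EuclideanSpace ℝ (Fin p)) (y : Fin n → ℝ) {lam : ℝ}
    (hlam : 0 < lam) : ∃ b, IsLasso x y lam b := by
  have hcont : Continuous (lassoObjective x y lam) := by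
    unfold lassoObjective l1; fun_prop
  have hle : ∀ θ, lam * ‖θ‖ ≤ lassoObjective x y lam θ := fun θ => by
    unfold lassoObjective
    have h1 : 0 ≤ 1 / (2 * (n : ℝ)) * ∑ i, (y i - inner ℝ (x i) θ) ^ 2 := by positivity
    have h2 := mul_le_mul_of_nonneg_left (norm_le_l1 θ) hlam.le
    linarith
  obtain ⟨b, hb⟩ := hcont.exists_forall_le
    (Filter.tendsto_atTop_mono hle (tendsto_norm_cocompact_atTop.const_mul_atTop hlam))
  exact ⟨b, fun θ _ => hb θ⟩

/-- The deterministic error bound for the Lasso under a restricted eigenvalue condition. -/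
lemma IsLasso.norm_sub_le {x : Fin n → EuclideanSpace ℝ (Fin p)} {y : Fin n → ℝ} {lam : ℝ}
    {b β : EuclideanSpace ℝ (Fin p)} (hb : IsLasso x y lam b) (hlam : 0 < lam) {k : ℕ}
    (hβ : l0 β ≤ k)
    (hscore : ∀ j, |1 / (n : ℝ) * ∑ i, x i j * (y i - inner ℝ (x i) β)| ≤ lam / 2) {r : ℝ}
    (hr : 0 < r)
    (hre : ∀ δ : EuclideanSpace ℝ (Fin p), l1 δ ≤ 4 * √k * ‖δ‖ →
      r / 2 * ‖δ‖ ^ 2 ≤ 1 / (n : ℝ) * ∑ i, (inner ℝ (x i) δ) ^ 2) :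
    ‖b - β‖ ≤ 6 * √k * lam / r := by
  classical
  set δ := b - β with hδ
  have hbδ : b = β + δ := by rw [hδ]; abel
  set Q := 1 / (n : ℝ) * ∑ i, (inner ℝ (x i) δ) ^ 2 with hQ
  have hQ0 : 0 ≤ Q := by positivity
  let s : Fin p → ℝ := fun j => 1 / (n : ℝ) * ∑ i, x i j * (y i - inner ℝ (x i) β)
  have hlin : 1 / (n : ℝ) * ∑ i, (y i - inner ℝ (x i) β) * inner ℝ (x i) δ = ∑ j, δ j * s j := by
    simp only [inner_eq_sum (x _) δ, s, Finset.mul_sum]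
    rw [Finset.sum_comm]
    refine Finset.sum_congr rfl fun j _ => Finset.sum_congr rfl fun i _ => ?_
    ring
  have hlin' : ∑ j, δ j * s j ≤ l1 δ * (lam / 2) := by
    have := abs_dotProduct_le (fun j => δ j) s hscore
    exact (le_abs_self _).trans this
  have hexp : 1 / (2 * (n : ℝ)) * ∑ i, (y i - inner ℝ (x i) b) ^ 2 =
      1 / (2 * (n : ℝ)) * ∑ i, (y i - inner ℝ (x i) β) ^ 2 - ∑ j, δ j * s j + Q / 2 := by
    rw [← hlin, hQ, hbδ]
    simp only [inner_add_right]
    simp only [Finset.mul_sum, Finset.sum_div]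
    rw [← Finset.sum_sub_distrib, ← Finset.sum_add_distrib]
    refine Finset.sum_congr rfl fun i _ => ?_
    ring
  have hmin : lassoObjective x y lam b ≤ lassoObjective x y lam β := hb (Set.mem_univ β)
  unfold lassoObjective at hmin
  rw [hexp] at hmin
  set A := ∑ j ∈ Finset.univ.filter (fun j => β j ≠ 0), |δ j| with hA
  set C := ∑ j ∈ Finset.univ.filter (fun j => ¬ β j ≠ 0), |δ j| with hC
  have hAC : l1 δ = A + C := (Finset.sum_filter_add_sum_filter_not _ _ _).symm
  have hC0 : 0 ≤ C := Finset.sum_nonneg fun _ _ => abs_nonneg _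
  have hl1 : l1 β - l1 b ≤ A - C := by
    unfold l1
    rw [← Finset.sum_sub_distrib,
      ← Finset.sum_filter_add_sum_filter_not Finset.univ (fun j => β j ≠ 0), hA, hC,
      sub_eq_add_neg (∑ j ∈ _, |δ j|), ← Finset.sum_neg_distrib]
    refine add_le_add (Finset.sum_le_sum fun j _ => ?_) (Finset.sum_le_sum fun j hj => ?_)
    · have h1 : |β j| - |b j| ≤ |β j - b j| := abs_sub_abs_le_abs_sub _ _
      rw [abs_sub_comm] at h1
      simpa [hδ] using h1
    · have h0 : β j = 0 := by simpa using (Finset.mem_filter.1 hj).2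
      simp [hδ, h0]
  have hAn : A ≤ √k * ‖δ‖ := by
    have h1 : A ^ 2 ≤ k * ‖δ‖ ^ 2 := by
      calc A ^ 2 ≤ (Finset.univ.filter (fun j => β j ≠ 0)).card *
              ∑ j ∈ Finset.univ.filter (fun j => β j ≠ 0), |δ j| ^ 2 := sq_sum_le_card_mul_sum_sq
        _ ≤ k * ‖δ‖ ^ 2 := by
            rw [EuclideanSpace.norm_sq_eq]
            have : (((Finset.univ.filter (fun j => β j ≠ 0)).card : ℕ) : ℝ) ≤ k := by
              refine Nat.cast_le.2 (le_of_eq_of_le ?_ hβ)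
              unfold l0 hammingNorm
              congr
            refine mul_le_mul this ?_ (by positivity) (by positivity)
            exact Finset.sum_le_sum_of_subset_of_nonneg (Finset.filter_subset _ _)
              fun _ _ _ => by positivity
    refine abs_le_of_sq_le_sq' ?_ (by positivity) |>.2
    rwa [mul_pow, Real.sq_sqrt (by positivity)]
  -- Minimality reads Q/2 ≤ (λ/2)(A + C) + λ(A - C) = (λ/2)(3A - C). Then Q ≥ 0 gives the cone
  -- condition, and C ≥ 0 the bound on Q.
  have hcone : C ≤ 3 * A := by nlinarith
  have hQA : Q ≤ 3 * lam * A := by nlinarith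
  have hδ0 := norm_nonneg δ
  have h1 := hre δ (by rw [hAC]; linarith)
  rcases hδ0.eq_or_lt with h | h
  · rw [← h]; positivity
  · rw [le_div_iff₀ hr]
    have h2 : r / 2 * ‖δ‖ ^ 2 ≤ 3 * lam * (√k * ‖δ‖) :=
      h1.trans (hQA.trans (by gcongr))
    have h3 : r / 2 * ‖δ‖ ≤ 3 * lam * √k := by
      refine le_of_mul_le_mul_right ?_ h
      linarith
    linarith

end Lasso

end SubWeibullLasso

namespace SubWeibullLasso

/-! ### Concentration of sums of sub-Weibull variables. -/

section Score

variable {Ω : Type*} [MeasurableSpace Ω] {μ : Measure Ω} [IsProbabilityMeasure μ] {n : ℕ}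

lemma exp_neg_level (hn : 1 ≤ n) : Real.exp (-(2 * Real.log (2 * n) / 2)) = 1 / (2 * n) := by
  have hn0 : (0 : ℝ) < n := by exact_mod_cast hn
  rw [mul_div_cancel_left₀ _ two_ne_zero, Real.exp_neg, Real.exp_log (by positivity), one_div]

/-- Upper tail of the sum of the large values of independent sub-Weibull variables. -/
lemma measure_sum_large_le {w : Fin n → Ω → ℝ} (hn : 1 ≤ n) (hlog : 1 ≤ Real.log (2 * n))
    {γ : ℝ} (hγ : 0 < γ) (hw : ∀ i ω, 0 ≤ w i ω) (hind : iIndepFun (fun i ω => w i ω ^ γ) μ)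
    (hb : ∀ i, ExpMoment μ (fun ω => w i ω ^ γ)) (t : ℝ) :
    μ.real {ω | (2 * (t + 1)) ^ (1 / min γ 1) <
      ∑ i, (if 2 * Real.log (2 * n) < w i ω ^ γ then w i ω else 0)} ≤ Real.exp (-t) := by
  refine le_trans (measureReal_mono fun ω hω => ?_) (measure_sum_excess_le hn hind hb t)
  have hq : 0 < min γ 1 := lt_min hγ one_pos
  by_contra hlt
  have hlt' : ∑ i, (if 2 * Real.log (2 * n) < w i ω ^ γ then w i ω ^ γ else 0) < 2 * (t + 1) :=
    not_le.1 hlt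
  have hω' : (2 * (t + 1)) ^ (1 / min γ 1) <
    ∑ i, (if 2 * Real.log (2 * n) < w i ω ^ γ then w i ω else 0) := hω
  refine absurd hω' (not_lt.2 ?_)
  refine (sum_le_rpow_sum_rpow Finset.univ (q := min γ 1) (fun i => ?_) hq
    (min_le_right _ _)).trans ?_
  · split_ifs
    exacts [hw i ω, le_rfl]
  · refine Real.rpow_le_rpow (Finset.sum_nonneg fun i _ => ?_) ?_ (by positivity)
    · split_ifs
      exacts [Real.rpow_nonneg (hw i ω) _, Real.rpow_nonneg le_rfl _]
    · refine le_trans (Finset.sum_le_sum fun i _ => ?_) hlt'.le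
      split_ifs with h
      -- A surviving w has w^γ > 2 log(2n) > 1, hence w ≥ 1, and lowering the exponent to min γ 1
      -- lowers the power.
      · refine Real.rpow_le_rpow_of_exponent_le ?_ (min_le_left _ _)
        by_contra hc
        have := Real.rpow_le_one (hw i ω) (not_le.1 hc).le hγ.le
        linarith
      · rw [Real.zero_rpow hq.ne']

/-- A concentration inequality for sums of independent sub-Weibull variables, with the variance in
the leading term. -/
lemma measure_abs_sum_gt_le {x : Fin n → Ω → ℝ} (hn : 1 ≤ n) (hlog : 1 ≤ Real.log (2 * n))
    {γ κ : ℝ} (hγ : 0 < γ) (hκ : 0 < κ) (hx : ∀ i, Measurable (x i)) (hind : iIndepFun x μ)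
    (hb : ∀ i, ExpMoment μ (fun ω => (|x i ω| / κ) ^ γ)) (hmean : ∑ i, ∫ ω, x i ω ∂μ = 0)
    {V t : ℝ} (hV : ∑ i, variance (x i) μ ≤ V) (ht : 1 ≤ t) :
    μ.real {ω | 2 * √(V * t) + 6 * (κ * (2 * Real.log (2 * n)) ^ (1 / γ)) * t +
      κ * (2 * (t + 1)) ^ (1 / min γ 1) + κ * (2 / γ) ^ (1 / γ) < |∑ i, x i ω|} ≤
      3 * Real.exp (-t) := by
  have hn0 : (0 : ℝ) < n := by exact_mod_cast hn
  set τ := 2 * Real.log (2 * n) with hτ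
  have hτ0 : 0 < τ := by linarith
  set M := κ * τ ^ (1 / γ) with hM
  have hM0 : 0 < M := by positivity
  have hV0 : 0 ≤ V := (Finset.sum_nonneg fun i _ => variance_nonneg _ _).trans hV
  have hlarge : ∀ i ω, M < |x i ω| ↔ τ < (|x i ω| / κ) ^ γ := by
    intro i ω
    have h1 : M < |x i ω| ↔ τ ^ (1 / γ) < |x i ω| / κ := by
      rw [lt_div_iff₀ hκ, hM, mul_comm]
    rw [h1, one_div, Real.rpow_inv_lt_iff_of_pos hτ0.le (by positivity) hγ]
  have hrep : ∀ i ω, |x i ω| = κ * ((|x i ω| / κ) ^ γ) ^ (1 / γ) := by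
    intro i ω
    rw [← Real.rpow_mul (by positivity), mul_one_div_cancel hγ.ne', Real.rpow_one]
    field_simp
  let c : Fin n → Ω → ℝ := fun i ω => clip M (x i ω)
  have hcm : ∀ i, Measurable (c i) := fun i => (measurable_clip M).comp (hx i)
  have hcind : iIndepFun c μ := hind.comp (fun _ => clip M) (fun _ => measurable_clip M)
  have hcb : ∀ i ω, |c i ω| ≤ M := fun i ω => abs_clip_le hM0.le _
  have hci : ∀ i, Integrable (c i) μ := fun i =>
    Integrable.of_bound (hcm i).aestronglyMeasurable M (Filter.Eventually.of_forall (hcb i))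
  have hxi : ∀ i, Integrable (x i) μ := fun i =>
    ((hb i).moment (hx i) hκ.le (one_div_pos.2 hγ) fun ω => (hrep i ω).le).1
  have hx2 : ∀ i, MemLp (x i) 2 μ := fun i => by
    rw [memLp_two_iff_integrable_sq (hx i).aestronglyMeasurable]
    refine ((hb i).moment (g := fun ω => x i ω ^ 2) (s := 2 / γ) (c := κ ^ 2)
      ((hx i).pow_const 2) (by positivity) (by positivity) fun ω => ?_).1
    rw [abs_pow]
    conv_lhs => rw [hrep i ω]
    rw [mul_pow, ← Real.rpow_natCast (_ ^ (1 / γ)), ← Real.rpow_mul (by positivity)]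
    apply le_of_eq
    congr 2
    push_cast
    ring
  -- `bernstein` needs a positive variance bound and V may vanish. Adding M² costs 2Mt, which turns
  -- 4Mt into 6Mt.
  have hcV : ∑ i, variance (c i) μ ≤ V + M ^ 2 :=
    ((Finset.sum_le_sum fun i _ => variance_clip_le (hx i) (hx2 i) M).trans hV).trans
      (by linarith [sq_nonneg M])
  have hbern := bernstein hcind hcm hM0 (V := V + M ^ 2) (by positivity) (by linarith : 0 ≤ t)
    hcb hcV
  have hsqrt : √((V + M ^ 2) * t) ≤ √(V * t) + M * t := by
    rw [Real.sqrt_le_left (by positivity), add_sq, Real.sq_sqrt (by positivity)]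
    have : M ^ 2 * t ≤ (M * t) ^ 2 := by
      rw [mul_pow M t, sq t]
      exact mul_le_mul_of_nonneg_left (by nlinarith) (by positivity)
    have h2 : 0 ≤ 2 * √(V * t) * (M * t) := by positivity
    nlinarith
  have hrem := measure_sum_large_le (μ := μ) (w := fun i ω => |x i ω| / κ) hn hlog hγ
    (fun i ω => by positivity)
    (hind.comp (fun _ y => (|y| / κ) ^ γ)
      (fun _ => (measurable_norm.div_const κ).pow_const γ)) hb t
  have hbias : ∀ i, |∫ ω, c i ω ∂μ - ∫ ω, x i ω ∂μ| ≤ κ * (2 / γ) ^ (1 / γ) / n := by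
    intro i
    rw [abs_sub_comm, ← integral_sub (hxi i) (hci i)]
    refine abs_integral_le_integral_abs.trans ?_
    refine ((hb i).tail_moment (τ := τ) (s := 1 / γ) (c := κ) ((hx i).sub (hcm i)) hκ.le
      (by positivity) fun ω => ?_).2.trans ?_
    · refine (abs_sub_clip_le hM0.le (x i ω)).trans ?_
      simp only [hlarge]
      split_ifs
      exacts [(hrep i ω).le, le_rfl]
    · rw [hτ, exp_neg_level hn, mul_one_div]
      apply le_of_eq
      field_simp
  -- Only the sum of the means vanishes, so each clipped mean is compared with its own unclipped
  -- mean before summing.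
  have hbias' : |∑ i, ∫ ω, c i ω ∂μ| ≤ κ * (2 / γ) ^ (1 / γ) := by
    have h1 : ∑ i, ∫ ω, c i ω ∂μ = ∑ i, (∫ ω, c i ω ∂μ - ∫ ω, x i ω ∂μ) := by
      rw [Finset.sum_sub_distrib, hmean, sub_zero]
    rw [h1]
    refine (Finset.abs_sum_le_sum_abs _ _).trans
      ((Finset.sum_le_sum fun i _ => hbias i).trans (le_of_eq ?_))
    rw [Finset.sum_const, Finset.card_univ, Fintype.card_fin, nsmul_eq_mul]
    field_simp
  refine le_trans (measureReal_mono (s₂ := {ω | 2 * √((V + M ^ 2) * t) + 4 * M * t ≤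
      |∑ i, (c i ω - ∫ ω', c i ω' ∂μ)|} ∪ {ω | (2 * (t + 1)) ^ (1 / min γ 1) <
      ∑ i, (if τ < (|x i ω| / κ) ^ γ then |x i ω| / κ else 0)}) fun ω hω => ?_)
    ((measureReal_union_le _ _).trans (by linarith))
  by_contra hnot
  rw [Set.mem_union, not_or] at hnot
  have h1 : |∑ i, (c i ω - ∫ ω', c i ω' ∂μ)| < 2 * √((V + M ^ 2) * t) + 4 * M * t :=
    not_le.1 hnot.1
  have h2 : ∑ i, (if τ < (|x i ω| / κ) ^ γ then |x i ω| / κ else 0) ≤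
    (2 * (t + 1)) ^ (1 / min γ 1) := not_lt.1 hnot.2
  have h3 : ∑ i, |x i ω - c i ω| ≤ κ * (2 * (t + 1)) ^ (1 / min γ 1) := by
    refine le_trans ?_ (mul_le_mul_of_nonneg_left h2 hκ.le)
    rw [Finset.mul_sum]
    refine Finset.sum_le_sum fun i _ => (abs_sub_clip_le hM0.le (x i ω)).trans ?_
    simp only [hlarge]
    split_ifs
    · apply le_of_eq; field_simp
    · simp
  have h4 : ∑ i, x i ω = ∑ i, (c i ω - ∫ ω', c i ω' ∂μ) + ∑ i, (x i ω - c i ω) +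
      ∑ i, ∫ ω', c i ω' ∂μ := by
    rw [← Finset.sum_add_distrib, ← Finset.sum_add_distrib]
    exact Finset.sum_congr rfl fun i _ => by ring
  have h5 : |∑ i, x i ω| ≤ |∑ i, (c i ω - ∫ ω', c i ω' ∂μ)| + ∑ i, |x i ω - c i ω| +
      |∑ i, ∫ ω', c i ω' ∂μ| := by
    rw [h4]
    refine (abs_add_le _ _).trans (add_le_add ((abs_add_le _ _).trans ?_) le_rfl)
    exact add_le_add le_rfl (Finset.abs_sum_le_sum_abs _ _)
  have h6 : 2 * √(V * t) + 6 * M * t + κ * (2 * (t + 1)) ^ (1 / min γ 1) +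
    κ * (2 / γ) ^ (1 / γ) < |∑ i, x i ω| := hω
  linarith

/-- Tail and mean of the sums of large squares. -/
lemma sqTail_bounds {x : Fin n → Ω → ℝ} (hn : 1 ≤ n) (hlog : 1 ≤ Real.log (2 * n))
    {α κ : ℝ} (hα : 0 < α) (hα2 : α ≤ 2) (hκ : 0 < κ) (hx : ∀ i, Measurable (x i))
    (hind : iIndepFun x μ) (hb : ∀ i, ExpMoment μ (fun ω => (|x i ω| / κ) ^ α)) (t : ℝ) :
    (∀ i, Integrable (fun ω => sqTail (κ * (2 * Real.log (2 * n)) ^ (1 / α)) (x i ω)) μ) ∧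
    (∀ i, ∫ ω, sqTail (κ * (2 * Real.log (2 * n)) ^ (1 / α)) (x i ω) ∂μ ≤
      κ ^ 2 * (4 / α) ^ (2 / α) / n) ∧
    μ.real {ω | κ ^ 2 * (2 * (t + 1)) ^ (2 / α) <
      ∑ i, sqTail (κ * (2 * Real.log (2 * n)) ^ (1 / α)) (x i ω)} ≤ Real.exp (-t) := by
  have hn0 : (0 : ℝ) < n := by exact_mod_cast hn
  set τ := 2 * Real.log (2 * n) with hτ
  have hτ0 : 0 < τ := by linarith
  set M := κ * τ ^ (1 / α) with hM
  have hlarge : ∀ i ω, M < |x i ω| ↔ τ < (|x i ω| / κ) ^ α := by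
    intro i ω
    have h1 : M < |x i ω| ↔ τ ^ (1 / α) < |x i ω| / κ := by
      rw [lt_div_iff₀ hκ, hM, mul_comm]
    rw [h1, one_div, Real.rpow_inv_lt_iff_of_pos hτ0.le (by positivity) hα]
  have hpow : ∀ i ω, ((|x i ω| / κ) ^ 2) ^ (α / 2) = (|x i ω| / κ) ^ α := by
    intro i ω
    rw [← Real.rpow_natCast, ← Real.rpow_mul (by positivity)]
    congr 1; push_cast; ring
  have hrep : ∀ i ω, x i ω ^ 2 = κ ^ 2 * ((|x i ω| / κ) ^ α) ^ (2 / α) := by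
    intro i ω
    rw [← Real.rpow_mul (by positivity), mul_div_cancel₀ _ hα.ne', Real.rpow_two, div_pow, sq_abs]
    field_simp
  have htm : ∀ i, _ := fun i => (hb i).tail_moment (τ := τ) (s := 2 / α) (c := κ ^ 2)
    (g := fun ω => sqTail M (x i ω)) ((measurable_sqTail M).comp (hx i)) (by positivity)
    (by positivity) (fun ω => by
      rw [abs_of_nonneg (sqTail_nonneg _ _), sqTail]
      simp only [hlarge]
      split_ifs
      exacts [(hrep i ω).le, le_rfl])
  refine ⟨fun i => (htm i).1, fun i => ?_, ?_⟩
  · have h := (htm i).2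
    simp only [abs_of_nonneg (sqTail_nonneg _ _)] at h
    refine h.trans (le_of_eq ?_)
    rw [hτ, exp_neg_level hn, show 2 * (2 / α) = 4 / α by ring]
    field_simp
  -- The squares have exponent α/2, and α ≤ 2 makes the minimum with 1 equal to α/2; hence the power
  -- 2/α.
  · have h := measure_sum_large_le (μ := μ) (w := fun i ω => (|x i ω| / κ) ^ 2) hn hlog
      (half_pos hα) (fun i ω => by positivity) (by
        simp only [hpow]
        exact hind.comp (fun _ y => (|y| / κ) ^ α)
          (fun _ => (measurable_norm.div_const κ).pow_const α)) (by simpa only [hpow] using hb) t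
    rw [min_eq_left (by linarith : α / 2 ≤ 1), one_div_div] at h
    refine le_trans (measureReal_mono fun ω hω => ?_) h
    have hω' : κ ^ 2 * (2 * (t + 1)) ^ (2 / α) < ∑ i, sqTail M (x i ω) := hω
    have hs : ∑ i, sqTail M (x i ω) = κ ^ 2 * ∑ i, (if 2 * Real.log (2 * n) <
        ((|x i ω| / κ) ^ 2) ^ (α / 2) then (|x i ω| / κ) ^ 2 else 0) := by
      rw [Finset.mul_sum]
      refine Finset.sum_congr rfl fun i _ => ?_
      rw [hpow, sqTail]
      simp only [hlarge]
      rw [div_pow, sq_abs, ← hτ]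
      split_ifs
      · field_simp
      · simp
    rw [hs] at hω'
    exact lt_of_mul_lt_mul_left hω' (by positivity)

end Score

/-! ### Products of sub-Weibull variables. -/

section Product

variable {Ω : Type*} [MeasurableSpace Ω] {μ : Measure Ω}

/-- Products of sub-Weibull variables are sub-Weibull. -/
lemma ExpMoment.mul {f g : Ω → ℝ} (hf : Measurable f) (hg : Measurable g) {α ϑ γ κ : ℝ}
    (hα : 0 < α) (hϑ : 0 < ϑ) (hγ : 1 / γ = 1 / α + 1 / ϑ) (hκ : 0 < κ)
    (h₁ : ExpMoment μ (fun ω => (|f ω| / κ) ^ α)) (h₂ : ExpMoment μ (fun ω => (|g ω| / κ) ^ ϑ)) :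
    ExpMoment μ (fun ω => (|f ω * g ω| / κ ^ 2) ^ γ) := by
  have hγ0 : 0 < γ := by
    rw [← one_div_pos, hγ]; positivity
  have hw : γ / α + γ / ϑ = 1 := by
    have : γ * (1 / γ) = 1 := mul_one_div_cancel hγ0.ne'
    rw [hγ] at this
    rw [← this]; ring
  refine h₁.of_le_convex h₂ ((measurable_norm.comp (hf.mul hg)).div_const _ |>.pow_const _)
    (fun ω => by positivity) (w₁ := γ / α) (w₂ := γ / ϑ) (by positivity) (by positivity) hw
    fun ω => ?_
  have hu : 0 ≤ |f ω| / κ := by positivity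
  have hv : 0 ≤ |g ω| / κ := by positivity
  -- Weighted AM–GM with weights γ/α and γ/ϑ, which sum to 1, bounds the exponent of the product by
  -- a convex combination of the two given exponents.
  have h := Real.geom_mean_le_arith_mean2_weighted (w₁ := γ / α) (w₂ := γ / ϑ) (by positivity)
    (by positivity) (Real.rpow_nonneg hu α) (Real.rpow_nonneg hv ϑ) hw
  rw [← Real.rpow_mul hu, ← Real.rpow_mul hv, mul_div_cancel₀ _ hα.ne',
    mul_div_cancel₀ _ hϑ.ne', ← Real.mul_rpow hu hv] at h
  rwa [abs_mul, sq, mul_div_mul_comm]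

end Product

end SubWeibullLasso

namespace SubWeibullLasso

/-! ### Gram matrices and their concentration in one direction. -/

section Gram

open Matrix

variable {Ω : Type*} [MeasurableSpace Ω] {μ : Measure Ω} {n p : ℕ}

/-- The empirical gram matrix of the data `x`. -/
noncomputable def empGram (x : Fin n → Fin p → ℝ) : Matrix (Fin p) (Fin p) ℝ :=
  Matrix.of fun a b => 1 / (n : ℝ) * ∑ i, x i a * x i b

/-- The population gram matrix of the random vectors `x`. -/
noncomputable def popGram (μ : Measure Ω) (x : Fin n → Ω → Fin p → ℝ) :
    Matrix (Fin p) (Fin p) ℝ :=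
  Matrix.of fun a b => 1 / (n : ℝ) * ∑ i, ∫ ω, x i ω a * x i ω b ∂μ

lemma empGram_mulVec (x : Fin n → Fin p → ℝ) (η : Fin p → ℝ) (j : Fin p) :
    (empGram x *ᵥ η) j = 1 / (n : ℝ) * ∑ i, (x i ⬝ᵥ η) * x i j := by
  simp only [empGram, mulVec, dotProduct, of_apply, Finset.mul_sum, Finset.sum_mul]
  rw [Finset.sum_comm]
  refine Finset.sum_congr rfl fun i _ => Finset.sum_congr rfl fun b _ => ?_
  ring

lemma empGram_quadratic (x : Fin n → Fin p → ℝ) (θ : Fin p → ℝ) :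
    θ ⬝ᵥ empGram x *ᵥ θ = 1 / (n : ℝ) * ∑ i, (x i ⬝ᵥ θ) ^ 2 := by
  conv_lhs => rw [dotProduct]
  simp only [empGram_mulVec, Finset.mul_sum]
  rw [Finset.sum_comm]
  refine Finset.sum_congr rfl fun i _ => ?_
  rw [sq]
  conv_rhs => rw [dotProduct, Finset.sum_mul, Finset.mul_sum]
  refine Finset.sum_congr rfl fun j _ => ?_
  rw [dotProduct]
  ring

lemma empGram_posSemidef (x : Fin n → Fin p → ℝ) : (empGram x).PosSemidef := by
  refine PosSemidef.of_dotProduct_mulVec_nonneg ?_ fun θ => ?_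
  · ext a b
    simp [empGram, mul_comm]
  · rw [star_trivial, empGram_quadratic]
    positivity

lemma popGram_mulVec {x : Fin n → Ω → Fin p → ℝ}
    (hx : ∀ i a b, Integrable (fun ω => x i ω a * x i ω b) μ) (η : Fin p → ℝ) (j : Fin p) :
    (popGram μ x *ᵥ η) j = 1 / (n : ℝ) * ∑ i, ∫ ω, (x i ω ⬝ᵥ η) * x i ω j ∂μ := by
  have h : ∀ i, ∫ ω, (x i ω ⬝ᵥ η) * x i ω j ∂μ = ∑ b, (∫ ω, x i ω j * x i ω b ∂μ) * η b := by
    intro i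
    simp only [← integral_mul_const]
    rw [← integral_finsetSum _ fun b _ => (hx i j b).mul_const _]
    refine integral_congr_ae (Filter.Eventually.of_forall fun ω => ?_)
    simp only [dotProduct, Finset.sum_mul]
    exact Finset.sum_congr rfl fun b _ => by ring
  simp only [h]
  simp only [popGram, mulVec, dotProduct, of_apply, Finset.mul_sum, Finset.sum_mul]
  rw [Finset.sum_comm]
  refine Finset.sum_congr rfl fun i _ => Finset.sum_congr rfl fun b _ => ?_
  ring

lemma integrable_dotProduct_mul {x : Fin n → Ω → Fin p → ℝ}
    (hx : ∀ i a b, Integrable (fun ω => x i ω a * x i ω b) μ) (η : Fin p → ℝ) (i : Fin n)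
    (j : Fin p) : Integrable (fun ω => (x i ω ⬝ᵥ η) * x i ω j) μ := by
  simp only [dotProduct, Finset.sum_mul]
  refine integrable_finsetSum _ fun b _ => ((hx i b j).mul_const (η b)).congr
    (Filter.Eventually.of_forall fun ω => ?_)
  ring

lemma popGram_quadratic {x : Fin n → Ω → Fin p → ℝ}
    (hx : ∀ i a b, Integrable (fun ω => x i ω a * x i ω b) μ) (θ : Fin p → ℝ) :
    θ ⬝ᵥ popGram μ x *ᵥ θ = 1 / (n : ℝ) * ∑ i, ∫ ω, (x i ω ⬝ᵥ θ) ^ 2 ∂μ := by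
  have h : ∀ i, ∫ ω, (x i ω ⬝ᵥ θ) ^ 2 ∂μ = ∑ j, θ j * ∫ ω, (x i ω ⬝ᵥ θ) * x i ω j ∂μ := by
    intro i
    simp only [← integral_const_mul]
    rw [← integral_finsetSum _ fun j _ => (integrable_dotProduct_mul hx θ i j).const_mul _]
    refine integral_congr_ae (Filter.Eventually.of_forall fun ω => ?_)
    simp only [sq]
    conv_lhs => rw [dotProduct, Finset.mul_sum]
    refine Finset.sum_congr rfl fun j _ => ?_
    rw [dotProduct]
    ring
  conv_lhs => rw [dotProduct]
  simp only [popGram_mulVec hx, h, Finset.mul_sum]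
  rw [Finset.sum_comm]
  exact Finset.sum_congr rfl fun i _ => Finset.sum_congr rfl fun j _ => by ring

lemma popGram_posSemidef {x : Fin n → Ω → Fin p → ℝ}
    (hx : ∀ i a b, Integrable (fun ω => x i ω a * x i ω b) μ) : (popGram μ x).PosSemidef := by
  refine PosSemidef.of_dotProduct_mulVec_nonneg ?_ fun θ => ?_
  · ext a b
    simp [popGram, mul_comm]
  · rw [star_trivial, popGram_quadratic hx]
    exact mul_nonneg (by positivity)
      (Finset.sum_nonneg fun i _ => integral_nonneg fun ω => sq_nonneg _)

variable [IsProbabilityMeasure μ]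

/-- Concentration of the empirical gram matrix of bounded vectors along a fixed direction, at the
scale of the population quadratic form. -/
lemma measure_gram_direction_le {x : Fin n → Ω → Fin p → ℝ} (hn : 1 ≤ n)
    (hm : ∀ i, Measurable (x i)) (hind : iIndepFun x μ) {M R t : ℝ} (hM : 0 < M) (hR : 0 < R)
    (ht : 0 ≤ t) (hb : ∀ i ω j, |x i ω j| ≤ M) {η : Fin p → ℝ} (hη : ∑ j, |η j| ≤ R)
    (hA0 : 0 < η ⬝ᵥ popGram μ x *ᵥ η)
    (hA : 160000 * (R ^ 2 * M ^ 2 * t) ≤ n * (η ⬝ᵥ popGram μ x *ᵥ η)) (j : Fin p) :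
    μ.real {ω | (η ⬝ᵥ popGram μ x *ᵥ η) / (100 * R) ≤
      |(empGram (fun i => x i ω) *ᵥ η) j - (popGram μ x *ᵥ η) j|} ≤ 2 * Real.exp (-t) := by
  have hn0 : (0 : ℝ) < n := by exact_mod_cast hn
  have hmc : ∀ i j, Measurable (fun ω => x i ω j) := fun i j => (measurable_pi_apply j).comp (hm i)
  have hx : ∀ i a b, Integrable (fun ω => x i ω a * x i ω b) μ := fun i a b =>
    Integrable.of_bound ((hmc i a).mul (hmc i b)).aestronglyMeasurable (M * M)
      (Filter.Eventually.of_forall fun ω => by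
        rw [Real.norm_eq_abs, abs_mul]
        exact mul_le_mul (hb i ω a) (hb i ω b) (abs_nonneg _) hM.le)
  set A := η ⬝ᵥ popGram μ x *ᵥ η with hAdef
  have hgm : Measurable (fun v : Fin p → ℝ => (v ⬝ᵥ η) * v j) := by
    unfold dotProduct; fun_prop
  let W : Fin n → Ω → ℝ := fun i ω => (x i ω ⬝ᵥ η) * x i ω j
  have hWm : ∀ i, Measurable (W i) := fun i => hgm.comp (hm i)
  have hWind : iIndepFun W μ := hind.comp (fun _ v => (v ⬝ᵥ η) * v j) (fun _ => hgm)
  have hdot : ∀ i ω, |x i ω ⬝ᵥ η| ≤ R * M := fun i ω => by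
    rw [dotProduct_comm]
    exact (abs_dotProduct_le η _ (hb i ω)).trans (by gcongr)
  have hWb : ∀ i ω, |W i ω| ≤ R * M * M := fun i ω => by
    simp only [W, abs_mul]
    exact mul_le_mul (hdot i ω) (hb i ω j) (abs_nonneg _) (by positivity)
  have hdm : ∀ i, Measurable (fun ω => x i ω ⬝ᵥ η) := fun i => by
    have : Measurable (fun v : Fin p → ℝ => v ⬝ᵥ η) := by unfold dotProduct; fun_prop
    exact this.comp (hm i)
  -- Bounding only the factor x_j by M leaves E(x'η)², so the variances sum to at most M²nA: the
  -- fluctuation scales with the form A itself.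
  have hWv : ∀ i, variance (W i) μ ≤ M ^ 2 * ∫ ω, (x i ω ⬝ᵥ η) ^ 2 ∂μ := fun i => by
    refine (variance_le_expectation_sq (hWm i).aestronglyMeasurable).trans ?_
    rw [← integral_const_mul]
    have hle : ∀ ω, (W i ^ 2) ω ≤ M ^ 2 * (x i ω ⬝ᵥ η) ^ 2 := fun ω => by
      have h1 : x i ω j ^ 2 ≤ M ^ 2 := sq_le_sq.2 (by rw [abs_of_pos hM]; exact hb i ω j)
      simp only [W, Pi.pow_apply, mul_pow]
      nlinarith [sq_nonneg (x i ω ⬝ᵥ η)]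
    have hi : Integrable (fun ω => M ^ 2 * (x i ω ⬝ᵥ η) ^ 2) μ :=
      (Integrable.of_bound ((hdm i).pow_const 2).aestronglyMeasurable ((R * M) ^ 2)
        (Filter.Eventually.of_forall fun ω => by
          rw [Real.norm_eq_abs, abs_pow]; gcongr; exact hdot i ω)).const_mul _
    refine integral_mono (hi.mono' ((hWm i).pow_const 2).aestronglyMeasurable
      (Filter.Eventually.of_forall fun ω => ?_)) hi hle
    rw [Real.norm_eq_abs, abs_of_nonneg (by simp only [Pi.pow_apply]; positivity)]
    exact hle ω
  have hV : ∑ i, variance (W i) μ ≤ M ^ 2 * (n * A) := by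
    refine (Finset.sum_le_sum fun i _ => hWv i).trans (le_of_eq ?_)
    rw [← Finset.mul_sum, hAdef, popGram_quadratic hx]
    field_simp
  refine le_trans (measureReal_mono fun ω hω => ?_)
    (bernstein hWind hWm (by positivity : 0 < R * M * M) (by positivity) ht hWb hV)
  have hω' : A / (100 * R) ≤
    |(empGram (fun i => x i ω) *ᵥ η) j - (popGram μ x *ᵥ η) j| := hω
  rw [empGram_mulVec, popGram_mulVec hx, ← mul_sub, ← Finset.sum_sub_distrib, abs_mul,
    abs_of_pos (by positivity : 0 < 1 / (n : ℝ)), one_div_mul_eq_div, le_div_iff₀ hn0] at hω'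
  change 2 * √(M ^ 2 * (n * A) * t) + 4 * (R * M * M) * t ≤ |∑ i, (W i ω - ∫ ω', W i ω' ∂μ)|
  refine le_trans ?_ hω'
  -- Here 160000 = 400². The two Bernstein terms then contribute nA/(200R) each.
  have h1 : √(M ^ 2 * (n * A) * t) ≤ n * A / (400 * R) := by
    rw [Real.sqrt_le_left (by positivity), div_pow, le_div_iff₀ (by positivity)]
    have : 0 ≤ (n : ℝ) * A := by positivity
    nlinarith
  have h2 : 4 * (R * M * M) * t ≤ n * A / (200 * R) := by
    rw [le_div_iff₀ (by positivity)]
    have : 0 ≤ R ^ 2 * M ^ 2 * t := by positivity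
    nlinarith
  calc 2 * √(M ^ 2 * (n * A) * t) + 4 * (R * M * M) * t
      ≤ 2 * (n * A / (400 * R)) + n * A / (200 * R) := by linarith
    _ = A / (100 * R) * n := by field_simp; ring

end Gram

end SubWeibullLasso

namespace SubWeibullLasso

/-! ### The restricted eigenvalue condition. -/

section RestrictedEigenvalue

open Matrix

variable {Ω : Type*} [MeasurableSpace Ω] {μ : Measure Ω} {n p : ℕ}

lemma measurable_coord {X : Ω → EuclideanSpace ℝ (Fin p)} (hX : Measurable X) (j : Fin p) :
    Measurable (fun ω => X ω j) := by fun_prop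

lemma integrable_coord_mul {X : Fin n → Ω → EuclideanSpace ℝ (Fin p)}
    (hX : ∀ i, Measurable (X i)) {α κ : ℝ} (hα : 0 < α) (hκ : 0 < κ)
    (hb : ∀ i j, ExpMoment μ (fun ω => (|X i ω j| / κ) ^ α)) (i : Fin n) :
    (∀ a, ∫ ω, X i ω a * X i ω a ∂μ ≤ 2 * κ ^ 2 * (4 / α) ^ (2 / α)) ∧
    ∀ a b, Integrable (fun ω => X i ω a * X i ω b) μ := by
  have hc := fun j => measurable_coord (hX i) j
  have hsq : ∀ a, _ := fun a => (hb i a).moment (g := fun ω => X i ω a * X i ω a)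
    (c := κ ^ 2) (s := 2 / α) ((hc a).mul (hc a)) (by positivity) (by positivity) (fun ω => by
      rw [← Real.rpow_mul (by positivity), mul_div_cancel₀ _ hα.ne', Real.rpow_two, div_pow,
        sq_abs, abs_mul_self]
      apply le_of_eq
      field_simp)
  refine ⟨fun a => ?_, fun a b => ?_⟩
  · have h := (hsq a).2
    simp only [abs_mul_self] at h
    rwa [show 2 * (2 / α) = 4 / α by ring] at h
  · refine ((hsq a).1.add (hsq b).1).mono' ((hc a).mul (hc b)).aestronglyMeasurable
      (Filter.Eventually.of_forall fun ω => ?_)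
    rw [Real.norm_eq_abs, Pi.add_apply, abs_mul]
    nlinarith [sq_nonneg (|X i ω a| - |X i ω b|), sq_abs (X i ω a), sq_abs (X i ω b),
      mul_self_nonneg (X i ω a), mul_self_nonneg (X i ω b)]

lemma abs_entry_average_sub_le {f g h : Fin n → ℝ} (hf : ∀ i, |f i - g i| ≤ h i) :
    |1 / (n : ℝ) * ∑ i, f i - 1 / (n : ℝ) * ∑ i, g i| ≤ 1 / (n : ℝ) * ∑ i, h i := by
  rw [← mul_sub, ← Finset.sum_sub_distrib, abs_mul, abs_of_nonneg (by positivity)]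
  gcongr
  exact (Finset.abs_sum_le_sum_abs _ _).trans (Finset.sum_le_sum fun i _ => hf i)

lemma gram_eq_popGram (X : Fin n → Ω → EuclideanSpace ℝ (Fin p)) :
    gram μ X = popGram μ (fun i ω => ⇑(X i ω)) := rfl

variable [IsProbabilityMeasure μ]

set_option maxHeartbeats 1000000 in
/-- A restricted eigenvalue condition holds with high probability. -/
lemma restricted_eigenvalue {X : Fin n → Ω → EuclideanSpace ℝ (Fin p)} (hn : 1 ≤ n)
    (hlog : 1 ≤ Real.log (2 * n)) {k : ℕ} (hk : 1 ≤ k) {α K r B ν : ℝ} (hα : 0 < α) (hα2 : α ≤ 2)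
    (hK : 0 < K) (hX : ∀ i, Measurable (X i)) (hind : iIndepFun X μ)
    (hb : ∀ i j, ExpMoment μ (fun ω => (|X i ω j| / (2 * K)) ^ α)) (hr0 : 0 < r)
    (hr : r ≤ lambdaMin (gram μ X)) (hB : 1 ≤ B)
    (hcount : (2 * p + 1 : ℝ) ^ (64 * k) * (p * (2 * Real.exp (-(67 * B)))) ≤ ν)
    (hp : p * Real.exp (-(2 * B)) ≤ ν)
    (hsize : 10 ^ 11 * (6 + 4 / α) ^ (2 / α) *
      (K ^ 2 * k * Real.log (2 * n) ^ (2 / α) * B ^ (2 / α)) ≤ n * r) :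
    ∃ bad : Set Ω, μ.real bad ≤ 2 * ν ∧ ∀ ω ∉ bad, ∀ δ : EuclideanSpace ℝ (Fin p),
      l1 δ ≤ 4 * √k * ‖δ‖ → r / 2 * ‖δ‖ ^ 2 ≤ 1 / (n : ℝ) * ∑ i, (inner ℝ (X i ω) δ) ^ 2 := by
  have hn0 : (0 : ℝ) < n := by exact_mod_cast hn
  have hk0 : (0 : ℝ) < k := by exact_mod_cast hk
  have hsk : 0 < √(k : ℝ) := Real.sqrt_pos.2 hk0
  have hR2 : (4 * √(k : ℝ)) ^ 2 = 16 * k := by rw [mul_pow, Real.sq_sqrt hk0.le]; norm_num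
  have h2α : 1 ≤ 2 / α := (one_le_div hα).2 hα2
  set G := (6 + 4 / α) ^ (2 / α) with hG
  set ℓ := Real.log (2 * n) ^ (2 / α) with hℓ
  have hℓ1 : 1 ≤ ℓ := Real.one_le_rpow hlog (by positivity)
  have hBB : B ≤ B ^ (2 / α) := by
    simpa using Real.rpow_le_rpow_of_exponent_le hB h2α
  have hG6 : (6 : ℝ) ^ (2 / α) ≤ G :=
    Real.rpow_le_rpow (by norm_num) (by linarith [show 0 < 4 / α by positivity]) (by positivity)
  have hG2 : (2 : ℝ) ^ (2 / α) ≤ G :=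
    Real.rpow_le_rpow (by norm_num) (by linarith [show 0 < 4 / α by positivity]) (by positivity)
  have hG4 : (4 / α) ^ (2 / α) ≤ G := Real.rpow_le_rpow (by positivity) (by linarith) (by positivity)
  have hG0 : 0 < G := by positivity
  set M := 2 * K * (2 * Real.log (2 * n)) ^ (1 / α) with hM
  have hM0 : 0 < M := by positivity
  have hM2 : M ^ 2 = 4 * K ^ 2 * ((2 : ℝ) ^ (2 / α) * ℓ) := by
    rw [hM, mul_pow, ← Real.rpow_natCast (_ ^ (1 / α)), ← Real.rpow_mul (by positivity), hℓ,
      ← Real.mul_rpow (by norm_num) (by linarith), mul_pow]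
    norm_num
    left
    congr 1
    field_simp
  have hc := fun i j => measurable_coord (hX i) j
  have hclipm : Measurable (fun (v : EuclideanSpace ℝ (Fin p)) (j : Fin p) => clip M (v j)) :=
    measurable_pi_lambda _ fun j => (measurable_clip M).comp (by fun_prop)
  let x : Fin n → Ω → Fin p → ℝ := fun i ω j => clip M (X i ω j)
  have hxm : ∀ i, Measurable (x i) := fun i => hclipm.comp (hX i)
  have hxind : iIndepFun x μ := hind.comp _ fun _ => hclipm
  have hxb : ∀ i ω j, |x i ω j| ≤ M := fun i ω j => abs_clip_le hM0.le _
  have hxc : ∀ i j, Measurable (fun ω => x i ω j) := fun i j =>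
    (measurable_clip M).comp (hc i j)
  have hxi : ∀ i a b, Integrable (fun ω => x i ω a * x i ω b) μ := fun i a b =>
    Integrable.of_bound ((hxc i a).mul (hxc i b)).aestronglyMeasurable (M * M)
      (Filter.Eventually.of_forall fun ω => by
        rw [Real.norm_eq_abs, abs_mul]
        exact mul_le_mul (hxb i ω a) (hxb i ω b) (abs_nonneg _) hM0.le)
  have hXi := fun i => (integrable_coord_mul hX hα (by positivity) hb i).2
  set S := popGram μ x with hS
  have hSpsd : S.PosSemidef := popGram_posSemidef hxi
  have htail := fun j => sqTail_bounds (x := fun i ω => X i ω j) hn hlog hα hα2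
    (by positivity : 0 < 2 * K) (fun i => hc i j)
    (hind.comp (fun _ v => v j) (fun _ => by fun_prop)) (fun i => hb i j) (2 * B)
  simp only [← hM] at htail
  -- the population gram matrices with and without clipping
  have hpop : ∀ a b, |gram μ X a b - S a b| ≤ 8 * K ^ 2 * G / n := by
    intro a b
    refine (abs_entry_average_sub_le (h := fun _ => 2 * ((2 * K) ^ 2 * (4 / α) ^ (2 / α) / n))
      fun i => ?_).trans ?_
    · rw [← integral_sub (hXi i a b) (hxi i a b)]
      refine abs_integral_le_integral_abs.trans ?_
      refine (integral_mono ((hXi i a b).sub (hxi i a b)).abs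
        (((htail a).1 i).add ((htail b).1 i)) fun ω =>
          abs_mul_sub_clip_mul_clip_le hM0.le _ _).trans ?_
      simp only [Pi.add_apply]
      rw [integral_add ((htail a).1 i) ((htail b).1 i)]
      linarith [(htail a).2.1 i, (htail b).2.1 i]
    · rw [Finset.sum_const, Finset.card_univ, Fintype.card_fin, nsmul_eq_mul]
      have : 1 / (n : ℝ) * (n * (2 * ((2 * K) ^ 2 * (4 / α) ^ (2 / α) / n))) =
          8 * K ^ 2 * (4 / α) ^ (2 / α) / n := by field_simp; ring
      rw [this]
      gcongr
  have hm0 : 0 ≤ K ^ 2 * k * G * (ℓ * B ^ (2 / α)) := by positivity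
  have hD1 : K ^ 2 * k * G * 1 ≤ K ^ 2 * k * G * (ℓ * B ^ (2 / α)) := by
    gcongr
    nlinarith
  -- An entrywise error is multiplied by ‖θ‖₁² ≤ 16k in the quadratic form.
  have hpop16 : 16 * k * (8 * K ^ 2 * G / n) ≤ r / 100 := by
    rw [mul_div_assoc', div_le_iff₀ hn0]
    linarith
  -- The constant is 9/16 - 1/100 ≥ 11/20, after replacing the population Gram matrix by its clipped
  -- version.
  have hScert : ∀ θ : Fin p → ℝ, ∑ j, |θ j| ≤ 4 * √k → 9 / 16 ≤ ∑ j, θ j ^ 2 →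
      11 / 20 * r ≤ θ ⬝ᵥ S *ᵥ θ := by
    intro θ h1 h2
    have h3 := lambdaMin_mul_le (popGram_posSemidef hXi).isHermitian θ
    rw [← gram_eq_popGram] at h3
    have h4 := abs_quadratic_sub_le (gram μ X) S θ hpop
    have h5 : (∑ j, |θ j|) ^ 2 * (8 * K ^ 2 * G / n) ≤ 16 * k * (8 * K ^ 2 * G / n) := by
      rw [← hR2]
      have : 0 ≤ ∑ j, |θ j| := Finset.sum_nonneg fun j _ => abs_nonneg _
      gcongr
    have h6 := (abs_le.1 (h4.trans h5)).2
    have h7 : r * (9 / 16) ≤ lambdaMin (gram μ X) * ∑ j, θ j ^ 2 :=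
      mul_le_mul hr h2 (by norm_num) (hr0.le.trans hr)
    linarith
  obtain ⟨H, hHcard, hHprop, hHcov⟩ := exists_certificates hSpsd hk hScert
  have hsmall : ∀ η ∈ H, 160000 * ((4 * √(k : ℝ)) ^ 2 * M ^ 2 * (67 * B)) ≤
      n * (η ⬝ᵥ S *ᵥ η) := by
    intro η hη
    have h1 : n * (11 / 20 * r) ≤ n * (η ⬝ᵥ S *ᵥ η) := by
      gcongr; exact (hHprop η hη).2
    rw [hR2, hM2]
    have h2 : K ^ 2 * k * ℓ * ((2 : ℝ) ^ (2 / α) * B) ≤ K ^ 2 * k * ℓ * (G * B ^ (2 / α)) := by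
      gcongr
    linarith
  let badTail : Fin p → Set Ω := fun j =>
    {ω | (2 * K) ^ 2 * (2 * (2 * B + 1)) ^ (2 / α) < ∑ i, sqTail M (X i ω j)}
  let badDir : (Fin p → ℝ) → Fin p → Set Ω := fun η j =>
    {ω | (η ⬝ᵥ S *ᵥ η) / (100 * (4 * √k)) ≤
      |(empGram (fun i => x i ω) *ᵥ η) j - (S *ᵥ η) j|}
  refine ⟨(⋃ j, badTail j) ∪ ⋃ η ∈ H, ⋃ j, badDir η j, ?_, ?_⟩
  · refine (measureReal_union_le _ _).trans ?_
    have h1 : μ.real (⋃ j, badTail j) ≤ ν := by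
      refine (measureReal_iUnion_fintype_le _).trans
        ((Finset.sum_le_sum fun j _ => (htail j).2.2).trans ?_)
      rw [Finset.sum_const, Finset.card_univ, Fintype.card_fin, nsmul_eq_mul]
      exact hp
    have h2 : μ.real (⋃ η ∈ H, ⋃ j, badDir η j) ≤ ν := by
      refine (measureReal_biUnion_finset_le _ _).trans ?_
      have h3 : ∀ η ∈ H, μ.real (⋃ j, badDir η j) ≤ p * (2 * Real.exp (-(67 * B))) := by
        intro η hη
        refine (measureReal_iUnion_fintype_le _).trans ((Finset.sum_le_sum fun j _ =>
          measure_gram_direction_le hn hxm hxind hM0 (by positivity) (by positivity) hxb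
            (hHprop η hη).1 ?_ (hsmall η hη) j).trans ?_)
        · exact lt_of_lt_of_le (by positivity) (hHprop η hη).2
        · rw [Finset.sum_const, Finset.card_univ, Fintype.card_fin, nsmul_eq_mul]
      refine (Finset.sum_le_sum h3).trans ?_
      rw [Finset.sum_const, nsmul_eq_mul]
      refine le_trans ?_ hcount
      gcongr
      exact_mod_cast hHcard
    linarith
  · intro ω hω
    rw [Set.mem_union, not_or] at hω
    have hQ : ∀ j, ∑ i, sqTail M (X i ω j) ≤ (2 * K) ^ 2 * (6 * B) ^ (2 / α) := by
      intro j
      have h1 : ω ∉ badTail j := fun h => hω.1 (Set.mem_iUnion.2 ⟨j, h⟩)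
      exact (not_lt.1 h1).trans (mul_le_mul_of_nonneg_left
        (Real.rpow_le_rpow (by positivity) (by linarith) (by positivity)) (by positivity))
    have hD : ∀ η ∈ H, ∀ j, |(empGram (fun i => x i ω) *ᵥ η) j - (S *ᵥ η) j| ≤
        (η ⬝ᵥ S *ᵥ η) / (100 * (4 * √k)) := by
      intro η hη j
      have h1 : ω ∉ badDir η j := fun h =>
        hω.2 (Set.mem_iUnion₂.2 ⟨η, hη, Set.mem_iUnion.2 ⟨j, h⟩⟩)
      exact (not_le.1 h1).le
    have hemp : ∀ a b, |empGram (fun i => ⇑(X i ω)) a b - empGram (fun i => x i ω) a b| ≤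
        8 * K ^ 2 * (6 * B) ^ (2 / α) / n := by
      intro a b
      refine (abs_entry_average_sub_le (h := fun i => sqTail M (X i ω a) + sqTail M (X i ω b))
        fun i => abs_mul_sub_clip_mul_clip_le hM0.le _ _).trans ?_
      rw [Finset.sum_add_distrib, one_div_mul_eq_div]
      gcongr
      linarith [hQ a, hQ b]
    have hemp16 : 16 * k * (8 * K ^ 2 * (6 * B) ^ (2 / α) / n) ≤ r / 100 := by
      rw [mul_div_assoc', div_le_iff₀ hn0, Real.mul_rpow (by norm_num) (by linarith)]
      have h1 : K ^ 2 * k * (1 * (6 ^ (2 / α) * B ^ (2 / α))) ≤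
          K ^ 2 * k * (ℓ * (G * B ^ (2 / α))) := by gcongr
      linarith
    have hunit : ∀ δ : Fin p → ℝ, ∑ j, |δ j| ≤ 4 * √k → ∑ j, δ j ^ 2 = 1 →
        r / 2 ≤ 1 / (n : ℝ) * ∑ i, (⇑(X i ω) ⬝ᵥ δ) ^ 2 := by
      intro δ h1 h2
      obtain ⟨η, hη, hle⟩ := hHcov δ h1 h2
      have hA := (hHprop η hη).2
      have h3 := quadratic_lower_bound (empGram_posSemidef fun i => x i ω) h1 (hHprop η hη).1
        (div_nonneg (le_trans (by positivity) hA) (by positivity)) (hD η hη) hle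
      have h4 : 4 * √(k : ℝ) * ((η ⬝ᵥ S *ᵥ η) / (100 * (4 * √k))) = (η ⬝ᵥ S *ᵥ η) / 100 := by
        field_simp
      rw [h4] at h3
      have h5 := abs_quadratic_sub_le _ _ δ hemp
      have h6 : (∑ j, |δ j|) ^ 2 * (8 * K ^ 2 * (6 * B) ^ (2 / α) / n) ≤
          16 * k * (8 * K ^ 2 * (6 * B) ^ (2 / α) / n) := by
        rw [← hR2]
        have : 0 ≤ ∑ j, |δ j| := Finset.sum_nonneg fun j _ => abs_nonneg _
        gcongr
      -- The clipped form is at least (1 - 3/100)(11/20)r, and undoing the clipping costs r/100;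
      -- more than r/2 remains.
      have h7 := (abs_le.1 (h5.trans h6)).1
      rw [← empGram_quadratic]
      linarith
    intro δ hδ
    rcases (norm_nonneg δ).eq_or_lt with h0 | h0
    · rw [← h0, sq, mul_zero, mul_zero]
      positivity
    · have h1 := hunit (fun j => δ j / ‖δ‖) (by
        have : ∑ j, |δ j / ‖δ‖| = l1 δ / ‖δ‖ := by
          simp only [l1, Finset.sum_div, abs_div, abs_norm]
        rw [this, div_le_iff₀ h0]; exact hδ) (by
        simp only [div_pow, ← Finset.sum_div]
        rw [EuclideanSpace.norm_sq_eq]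
        simp only [Real.norm_eq_abs, sq_abs]
        refine div_self fun hz => h0.ne' ?_
        rw [EuclideanSpace.norm_eq]
        simp [hz])
      have h2 : ∀ i, (⇑(X i ω) ⬝ᵥ fun j => δ j / ‖δ‖) ^ 2 = (inner ℝ (X i ω) δ) ^ 2 / ‖δ‖ ^ 2 := by
        intro i
        rw [← div_pow, inner_eq_sum, Finset.sum_div, dotProduct]
        simp only [mul_div_assoc]
      simp only [h2, ← Finset.sum_div] at h1
      rw [mul_div_assoc', le_div_iff₀ (by positivity)] at h1
      exact h1

end RestrictedEigenvalue

end SubWeibullLasso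

namespace SubWeibullLasso

/-- The constant in the regularization parameter. -/
noncomputable def lamConst (γ : ℝ) : ℝ :=
  48 * 2 ^ (1 / γ) + 8 * 3 ^ (1 / min γ 1) + 8 * |2 / γ| ^ (1 / γ)

/-- The constant in the lower bound for the smallest eigenvalue. -/
noncomputable def eigConst (α : ℝ) : ℝ := 10 ^ 9 * (6 + 4 / |α|) ^ (2 / α)

lemma lamConst_pos (γ : ℝ) : 0 < lamConst γ := by unfold lamConst; positivity

lemma eigConst_pos (α : ℝ) : 0 < eigConst α := by unfold eigConst; positivity

/-! ### The score is dominated by the regularization parameter. -/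

section ScoreEvent

variable {Ω : Type*} [MeasurableSpace Ω] {μ : Measure Ω} [IsProbabilityMeasure μ] {n p : ℕ}

lemma err_measurable {X : Fin n → Ω → EuclideanSpace ℝ (Fin p)} {Y : Fin n → Ω → ℝ}
    (hX : ∀ i, Measurable (X i)) (hY : ∀ i, Measurable (Y i)) (β : EuclideanSpace ℝ (Fin p))
    (i : Fin n) : Measurable (err X Y β i) := by
  have h1 := hX i
  have h2 := hY i
  unfold err
  fun_prop

/-- With high probability the regularization parameter dominates twice the score. -/
lemma score_event {X : Fin n → Ω → EuclideanSpace ℝ (Fin p)} {Y : Fin n → Ω → ℝ}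
    {β : EuclideanSpace ℝ (Fin p)} (hn : 1 ≤ n) (hp : 1 ≤ p) (hlog : 1 ≤ Real.log (2 * n))
    (hT : 1 ≤ Real.log (n * p)) {γ K : ℝ} (hγ : 0 < γ) (hK : 0 < K)
    (hX : ∀ i, Measurable (X i)) (hY : ∀ i, Measurable (Y i))
    (hind : iIndepFun (fun i ω => (X i ω, Y i ω)) μ)
    (hmean : (1 / (n : ℝ)) • ∑ i, ∫ ω, err X Y β i ω • X i ω ∂μ = 0)
    (hb : ∀ i j, ExpMoment μ (fun ω => (|X i ω j * err X Y β i ω| / (2 * K) ^ 2) ^ γ)) :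
    ∃ bad : Set Ω, μ.real bad ≤ 3 / ((n : ℝ) * p) ∧ ∀ ω ∉ bad, ∀ j,
      |1 / (n : ℝ) * ∑ i, X i ω j * err X Y β i ω| ≤
        lamChoice n p γ K (lamConst γ) (sigma μ X Y β) / 2 := by
  have hn0 : (0 : ℝ) < n := by exact_mod_cast hn
  have hp0 : (0 : ℝ) < p := by exact_mod_cast hp
  have hn1 : (1 : ℝ) ≤ n := by exact_mod_cast hn
  have hem := err_measurable hX hY β
  have hxm : ∀ i j, Measurable (fun ω => X i ω j * err X Y β i ω) := fun i j =>
    (measurable_coord (hX i) j).mul (hem i)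
  have hxind : ∀ j, iIndepFun (fun i ω => X i ω j * err X Y β i ω) μ := fun j =>
    hind.comp (fun _ z => z.1 j * (z.2 - inner ℝ z.1 β)) (fun _ => by fun_prop)
  have hκ : (0 : ℝ) < (2 * K) ^ 2 := by positivity
  have hxi : ∀ i j, Integrable (fun ω => X i ω j * err X Y β i ω) μ := fun i j =>
    ((hb i j).moment (hxm i j) hκ.le (one_div_pos.2 hγ) fun ω => by
      rw [← Real.rpow_mul (by positivity), mul_one_div_cancel hγ.ne', Real.rpow_one]
      apply le_of_eq; field_simp).1
  have hvi : ∀ i j, Integrable (fun ω => (err X Y β i ω • X i ω) j) μ := fun i j =>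
    (hxi i j).congr (Filter.Eventually.of_forall fun ω => by simp [mul_comm])
  have hmean' : ∀ j, ∑ i, ∫ ω, X i ω j * err X Y β i ω ∂μ = 0 := by
    intro j
    have h1 : ∑ i, ∫ ω, err X Y β i ω • X i ω ∂μ = 0 :=
      (smul_eq_zero.1 hmean).resolve_left (by positivity)
    have h2 := congrArg (fun v : EuclideanSpace ℝ (Fin p) => v j) h1
    simp only [WithLp.ofLp_sum, Finset.sum_apply, PiLp.zero_apply] at h2
    rw [← h2]
    refine Finset.sum_congr rfl fun i _ => ?_
    rw [eval_integral_piLp (hvi i)]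
    exact integral_congr_ae (Filter.Eventually.of_forall fun ω => by simp [mul_comm])
  set T := Real.log (n * p) with hTdef
  set σ := sigma μ X Y β with hσ
  have hσ0 : 0 ≤ σ := Real.sqrt_nonneg _
  have hV : ∀ j, ∑ i, variance (fun ω => X i ω j * err X Y β i ω) μ ≤ n * σ ^ 2 := by
    intro j
    have hbdd : BddAbove (Set.range fun j : Fin p =>
        (1 / (n : ℝ)) * ∑ i, variance (fun ω => X i ω j * err X Y β i ω) μ) :=
      (Set.finite_range _).bddAbove
    have h1 := le_ciSup hbdd j
    have h0 : 0 ≤ (1 / (n : ℝ)) * ∑ i, variance (fun ω => X i ω j * err X Y β i ω) μ :=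
      mul_nonneg (by positivity) (Finset.sum_nonneg fun i _ => variance_nonneg _ _)
    rw [hσ, sigma, Real.sq_sqrt (h0.trans h1)]
    rw [one_div_mul_eq_div, div_le_iff₀ hn0, mul_comm] at h1
    exact h1
  -- Taking t = 2T gives 3(np)⁻² per coordinate, hence at most 3/(np) after the union over p
  -- coordinates.
  have htail := fun j => measure_abs_sum_gt_le (κ := (2 * K) ^ 2) (t := 2 * T) hn hlog hγ hκ
    (fun i => hxm i j) (hxind j) (fun i => hb i j) (hmean' j) (hV j) (by linarith)
  refine ⟨⋃ j, _, (measureReal_iUnion_fintype_le _).trans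
    ((Finset.sum_le_sum fun j _ => htail j).trans ?_), fun ω hω j => ?_⟩
  · rw [Finset.sum_const, Finset.card_univ, Fintype.card_fin, nsmul_eq_mul, two_mul, neg_add,
      Real.exp_add, Real.exp_neg, hTdef, Real.exp_log (by positivity)]
    have : (p : ℝ) * (3 * (((n : ℝ) * p)⁻¹ * ((n : ℝ) * p)⁻¹)) = 3 / ((n : ℝ) * p) * (1 / n) := by
      field_simp
    rw [this]
    exact mul_le_of_le_one_right (by positivity) ((div_le_one hn0).2 hn1)
  · have hnot := fun h => hω (Set.mem_iUnion.2 ⟨j, h⟩)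
    rw [Set.mem_ofPred_eq, imp_false, not_lt] at hnot
    rw [abs_mul, abs_of_pos (by positivity : 0 < 1 / (n : ℝ)), one_div_mul_eq_div,
      div_le_iff₀ hn0]
    refine hnot.trans ?_
    set ℓ := Real.log (2 * n) ^ (1 / γ) with hℓ
    have hℓ1 : 1 ≤ ℓ := Real.one_le_rpow hlog (by positivity)
    have hq : 0 < min γ 1 := lt_min hγ one_pos
    have hq1 : 1 ≤ 1 / min γ 1 := (one_le_div hq).2 (min_le_right _ _)
    set P := (2 * T) ^ (1 / min γ 1) with hP
    have hTP : 2 * T ≤ P := by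
      have := Real.rpow_le_rpow_of_exponent_le (by linarith : 1 ≤ 2 * T) hq1
      rwa [Real.rpow_one] at this
    have hs1 : √(n * σ ^ 2 * (2 * T)) = √2 * σ * √(n * T) := by
      rw [show n * σ ^ 2 * (2 * T) = 2 * (σ ^ 2 * (n * T)) by ring, Real.sqrt_mul (by norm_num),
        Real.sqrt_mul (by positivity), Real.sqrt_sq hσ0]
      ring
    have hs2 : √(T / n) * n = √(n * T) := by
      have : (n : ℝ) * T = T / n * n ^ 2 := by field_simp
      rw [this, Real.sqrt_mul (by positivity), Real.sqrt_sq hn0.le]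
    have hℓ2 : (2 * Real.log (2 * n)) ^ (1 / γ) = 2 ^ (1 / γ) * ℓ :=
      Real.mul_rpow (by norm_num) (by linarith)
    have e1 : (2 * K) ^ 2 * (2 ^ (1 / γ) * ℓ) * (2 * T) ≤ (2 * K) ^ 2 * (2 ^ (1 / γ) * ℓ) * P := by
      gcongr
    have e2 : (2 * K) ^ 2 * (2 * (2 * T + 1)) ^ (1 / min γ 1) ≤
        (2 * K) ^ 2 * (3 ^ (1 / min γ 1) * (P * ℓ)) := by
      have : (2 * (2 * T + 1)) ^ (1 / min γ 1) ≤ 3 ^ (1 / min γ 1) * P := by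
        rw [hP, ← Real.mul_rpow (by norm_num) (by linarith)]
        exact Real.rpow_le_rpow (by linarith) (by linarith) (by positivity)
      refine mul_le_mul_of_nonneg_left (this.trans ?_) hκ.le
      gcongr
      exact le_mul_of_one_le_right (by linarith) hℓ1
    have e3 : (2 * K) ^ 2 * (2 / γ) ^ (1 / γ) * 1 ≤
        (2 * K) ^ 2 * (2 / γ) ^ (1 / γ) * (P * ℓ) := by
      gcongr
      nlinarith
    have e4 : 2 * (√2 * σ * √(n * T)) ≤ 7 * √2 * σ * √(n * T) := by
      have : 0 ≤ √2 * σ * √(n * T) := by positivity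
      linarith
    -- With κ = 4K², the coefficient 24 is 6 · 4 from the clipping level, and the two 4s come from
    -- the large values and the bias. The base 3 reflects 2(2T + 1) ≤ 3 · 2T, valid as T ≥ 1.
    have hgoal : lamChoice n p γ K (lamConst γ) σ / 2 * n = 7 * √2 * σ * √(n * T) +
        (24 * 2 ^ (1 / γ) + 4 * 3 ^ (1 / min γ 1) + 4 * (2 / γ) ^ (1 / γ)) * K ^ 2 * ℓ * P := by
      rw [← hs2, lamChoice, lamConst, abs_of_pos (by positivity : 0 < 2 / γ), ← hTdef,
        ← hℓ, ← hP]
      field_simp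
      ring
    rw [hgoal, hs1, hℓ2]
    linarith

end ScoreEvent

end SubWeibullLasso

/-! ### The explicit rate and the assembly of the theorem. -/

namespace SubWeibullLasso

lemma lamChoice_pos {n p : ℕ} {γ K C s : ℝ} (hn : 0 < (n : ℝ)) (hlog : 0 < Real.log (2 * n))
    (hT : 0 < Real.log (n * p)) (hK : 0 < K) (hC : 0 < C) (hs : 0 ≤ s) :
    0 < lamChoice n p γ K C s := by
  unfold lamChoice
  positivity

lemma lambdaMin_le_diag {p : ℕ} {A : Matrix (Fin p) (Fin p) ℝ} (hA : A.IsHermitian) (j : Fin p) :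
    lambdaMin A ≤ A j j := by
  have h := lambdaMin_mul_le hA (Pi.single j 1)
  have h1 : ∑ i, (Pi.single j (1 : ℝ) : Fin p → ℝ) i ^ 2 = 1 := by
    simp [Pi.single_apply]
  rw [h1, mul_one] at h
  simpa using h

/-- The explicit rate obtained from the regularization parameter. -/
lemma rate_le {n p k : ℕ} (hn : (2 : ℝ) ≤ n) (hp : (1 : ℝ) ≤ p) (hlog : 0 ≤ Real.log (2 * n))
    (hT0 : 0 < Real.log (n * p)) {γ K C σ r : ℝ} (hγ : 0 < γ) (hr : 0 < r) (hC : 0 ≤ C) :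
    6 * √k * lamChoice n p γ K C σ / r ≤ 84 * √2 / r * (σ * √(k * Real.log (n * p) / n) +
      C * 2 ^ (1 / γ + 1 / min γ 1) * K ^ 2 * √k *
        (Real.log (n * p)) ^ (1 / γ + 1 / min γ 1) / n) := by
  have hn0 : (0 : ℝ) < n := by linarith
  rw [div_mul_eq_mul_div]
  refine div_le_div_of_nonneg_right ?_ hr.le
  rw [lamChoice]
  set T := Real.log (n * p) with hTdef
  -- 2n ≤ n² ≤ (np)², as n ≥ 2.
  have hlogT : Real.log (2 * n) ≤ 2 * T := by
    have h1 : Real.log (2 * n) = Real.log 2 + Real.log n := Real.log_mul (by norm_num) hn0.ne'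
    have h2 : Real.log 2 ≤ Real.log n := Real.log_le_log (by norm_num) hn
    have h3 : Real.log n ≤ T := Real.log_le_log hn0 (by nlinarith)
    linarith
  have hpow : Real.log (2 * n) ^ (1 / γ) * (2 * T) ^ (1 / min γ 1) ≤
      2 ^ (1 / γ + 1 / min γ 1) * T ^ (1 / γ + 1 / min γ 1) := by
    rw [← Real.mul_rpow (by norm_num) hT0.le, Real.rpow_add (by linarith)]
    gcongr
  have hsq : √(k * T / n) = √k * √(T / n) := by
    rw [mul_div_assoc, Real.sqrt_mul (by positivity)]
  have h2 : (1 : ℝ) ≤ √2 := Real.one_le_sqrt.2 (by norm_num)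
  have key : 6 * (C * K ^ 2 * √k / n * (Real.log (2 * n) ^ (1 / γ) * (2 * T) ^ (1 / min γ 1))) ≤
      84 * √2 * (C * K ^ 2 * √k / n *
        (2 ^ (1 / γ + 1 / min γ 1) * T ^ (1 / γ + 1 / min γ 1))) := by
    gcongr
    linarith
  rw [hsq]
  calc _ = 84 * √2 * (σ * (√k * √(T / n))) + 6 * (C * K ^ 2 * √k / n *
        (Real.log (2 * n) ^ (1 / γ) * (2 * T) ^ (1 / min γ 1))) := by ring
    _ ≤ 84 * √2 * (σ * (√k * √(T / n))) + 84 * √2 * (C * K ^ 2 * √k / n *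
        (2 ^ (1 / γ + 1 / min γ 1) * T ^ (1 / γ + 1 / min γ 1))) := by linarith
    _ = _ := by ring

end SubWeibullLasso

theorem mainTheorem8 :
    ∃ Cα Cγ Cγ' : ℝ → ℝ, (∀ t, 0 < Cα t) ∧ (∀ t, 0 < Cγ t) ∧ (∀ t, 0 < Cγ' t) ∧
      ∀ (Ω : Type*) [MeasurableSpace Ω] (μ : Measure Ω) [IsProbabilityMeasure μ]
        (n p k : ℕ) (α ϑ γ K : ℝ)
        (X : Fin n → Ω → EuclideanSpace ℝ (Fin p)) (Y : Fin n → Ω → ℝ)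
        (β₀ : EuclideanSpace ℝ (Fin p)),
        2 ≤ n → 1 ≤ p → 1 ≤ k →
        0 < α → α ≤ 2 → 0 < ϑ → 1 / γ = 1 / α + 1 / ϑ → 0 < K →
        (∀ i, Measurable (X i)) → (∀ i, Measurable (Y i)) →
        iIndepFun (fun i ω => (X i ω, Y i ω)) μ →
        (1 / (n : ℝ)) • ∑ i, ∫ ω, SubWeibullLasso.err X Y β₀ i ω • X i ω ∂μ = 0 →
        SubWeibullLasso.l0 β₀ ≤ k →
        (∀ i, max (SubWeibullLasso.marginalNorm μ α (X i))
          (SubWeibullLasso.orliczNorm μ (SubWeibullLasso.psi ϑ) (SubWeibullLasso.err X Y β₀ i))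
            ≤ ENNReal.ofReal K) →
        1782 * SubWeibullLasso.Xi μ X k α K (Cα α) ≤
          SubWeibullLasso.lambdaMin (SubWeibullLasso.gram μ X) →
        ∃ E : Set Ω, MeasurableSet E ∧
          1 - 3 / ((n : ℝ) * p) - 3 * k / ((n : ℝ) * p) ≤ μ.real E ∧
          ∀ ω ∈ E,
            (∃ b, SubWeibullLasso.IsLasso (fun i => X i ω) (fun i => Y i ω)
              (SubWeibullLasso.lamChoice n p γ K (Cγ γ) (SubWeibullLasso.sigma μ X Y β₀)) b) ∧
            ∀ b, SubWeibullLasso.IsLasso (fun i => X i ω) (fun i => Y i ω)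
              (SubWeibullLasso.lamChoice n p γ K (Cγ γ) (SubWeibullLasso.sigma μ X Y β₀)) b →
              ‖b - β₀‖ ≤ 84 * √2 / SubWeibullLasso.lambdaMin (SubWeibullLasso.gram μ X) *
                (SubWeibullLasso.sigma μ X Y β₀ * √(k * Real.log (n * p) / n) +
                  Cγ' γ * K ^ 2 * √k * (Real.log (n * p)) ^ (1 / γ + 1 / min γ 1) / n) := by
  refine ⟨SubWeibullLasso.eigConst, SubWeibullLasso.lamConst,
    fun γ => SubWeibullLasso.lamConst γ * 2 ^ (1 / γ + 1 / min γ 1),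
    SubWeibullLasso.eigConst_pos, SubWeibullLasso.lamConst_pos,
    fun γ => mul_pos (SubWeibullLasso.lamConst_pos γ) (by positivity), ?_⟩
  intro Ω _ μ _ n p k α ϑ γ K X Y β₀ hn hp hk hα hα2 hϑ hγ hK hX hY hind hmean hβ hnorm heig
  have hn2 : (2 : ℝ) ≤ n := by exact_mod_cast hn
  have hp1 : (1 : ℝ) ≤ p := by exact_mod_cast hp
  have hk1 : (1 : ℝ) ≤ k := by exact_mod_cast hk
  have hn0 : (0 : ℝ) < n := by linarith
  have hp0 : (0 : ℝ) < p := by linarith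
  have hk0 : (0 : ℝ) < k := by linarith
  have hnp0 : (0 : ℝ) < (n : ℝ) * p := by positivity
  -- In this case the claimed probability is at most 0 and the empty event serves. Otherwise np > 6,
  -- so log(np) ≥ 1.
  by_cases hnp : (n : ℝ) * p ≤ 3 + 3 * k
  · refine ⟨∅, MeasurableSet.empty, ?_, fun ω hω => absurd hω (Set.notMem_empty ω)⟩
    rw [measureReal_empty, sub_sub, ← add_div, sub_nonpos, one_le_div hnp0]
    exact hnp
  push Not at hnp
  have hγ0 : 0 < γ := by rw [← one_div_pos, hγ]; positivity
  have hT : 1 ≤ Real.log (n * p) := by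
    rw [Real.le_log_iff_exp_le hnp0]
    linarith [Real.exp_one_lt_d9]
  have hlog : 1 ≤ Real.log (2 * n) := by
    rw [Real.le_log_iff_exp_le (by positivity)]
    linarith [Real.exp_one_lt_d9]
  set T := Real.log (n * p) with hTdef
  set L := Real.log (36 * n * p / k) with hL
  have hL1 : 1 ≤ L := by
    rw [hL, Real.le_log_iff_exp_le (by positivity), le_div_iff₀ hk0]
    nlinarith [Real.exp_one_lt_d9]
  set B := k * L with hB
  have hB1 : 1 ≤ B := by nlinarith
  -- As L ≥ 1, kL ≥ L + (k - 1) ≥ L + log k ≥ T.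
  have hTB : T ≤ B := by
    have h1 : L = Real.log 36 + T - Real.log k := by
      rw [hL, mul_assoc, Real.log_div (by positivity) hk0.ne',
        Real.log_mul (by norm_num) hnp0.ne']
    have h2 := Real.log_le_sub_one_of_pos hk0
    have h3 : 0 ≤ Real.log 36 := Real.log_nonneg (by norm_num)
    nlinarith
  set r := SubWeibullLasso.lambdaMin (SubWeibullLasso.gram μ X) with hr
  set G := (6 + 4 / α) ^ (2 / α) with hG
  have hG0 : 0 < G := by positivity
  have hsize : 10 ^ 11 * G * (K ^ 2 * k * Real.log (2 * n) ^ (2 / α) * B ^ (2 / α)) ≤ n * r := by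
    -- The variance part of Ξ is dropped; 1782 · 10⁹ ≥ 10¹¹ supplies the constant.
    have h1 : SubWeibullLasso.eigConst α * K ^ 2 * k * Real.log (2 * n) ^ (2 / α) *
        B ^ (2 / α) / n ≤ SubWeibullLasso.Xi μ X k α K (SubWeibullLasso.eigConst α) := by
      unfold SubWeibullLasso.Xi
      exact le_add_of_nonneg_left (by positivity)
    have h2 : 1782 * (SubWeibullLasso.eigConst α * K ^ 2 * k * Real.log (2 * n) ^ (2 / α) *
        B ^ (2 / α) / n) ≤ r := by linarith
    rw [mul_div_assoc', div_le_iff₀ hn0, SubWeibullLasso.eigConst, abs_of_pos hα, ← hG] at h2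
    have h3 : 0 ≤ G * (K ^ 2 * k * Real.log (2 * n) ^ (2 / α) * B ^ (2 / α)) := by positivity
    linarith
  have hr0 : 0 < r := by
    have h1 : 0 < 10 ^ 11 * G * (K ^ 2 * k * Real.log (2 * n) ^ (2 / α) * B ^ (2 / α)) := by
      positivity
    exact pos_of_mul_pos_right (h1.trans_le hsize) hn0.le
  have hbX : ∀ i j, SubWeibullLasso.ExpMoment μ (fun ω => (|X i ω j| / (2 * K)) ^ α) :=
    fun i j => SubWeibullLasso.expMoment_of_orliczNorm_le
      (SubWeibullLasso.measurable_coord (hX i) j) hα hK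
      ((le_iSup (fun j => SubWeibullLasso.orliczNorm μ (SubWeibullLasso.psi α)
        (fun ω => X i ω j)) j).trans ((le_max_left _ _).trans (hnorm i)))
  have hbe : ∀ i, SubWeibullLasso.ExpMoment μ
      (fun ω => (|SubWeibullLasso.err X Y β₀ i ω| / (2 * K)) ^ ϑ) :=
    fun i => SubWeibullLasso.expMoment_of_orliczNorm_le
      (SubWeibullLasso.err_measurable hX hY β₀ i) hϑ hK ((le_max_right _ _).trans (hnorm i))
  -- A diagonal entry bounds r above by a multiple of K², while `hsize` bounds it below by a much
  -- larger multiple of K²k/n. The resulting k ≤ n is what gives 2p + 1 ≤ 36np/k.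
  have hkn : (k : ℝ) ≤ n := by
    have hXi := fun i => SubWeibullLasso.integrable_coord_mul hX hα
      (by positivity : 0 < 2 * K) hbX i
    let j₀ : Fin p := ⟨0, hp⟩
    have h1 : r ≤ 2 * (2 * K) ^ 2 * (4 / α) ^ (2 / α) := by
      have h2 := (SubWeibullLasso.popGram_posSemidef fun i => (hXi i).2).isHermitian
      rw [← SubWeibullLasso.gram_eq_popGram] at h2
      refine (SubWeibullLasso.lambdaMin_le_diag h2 j₀).trans ?_
      change 1 / (n : ℝ) * ∑ i, ∫ ω, X i ω j₀ * X i ω j₀ ∂μ ≤ _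
      rw [one_div_mul_eq_div, div_le_iff₀ hn0]
      refine (Finset.sum_le_sum fun i _ => (hXi i).1 j₀).trans (le_of_eq ?_)
      rw [Finset.sum_const, Finset.card_univ, Fintype.card_fin, nsmul_eq_mul, mul_comm]
    have h3 : (4 / α) ^ (2 / α) ≤ G :=
      Real.rpow_le_rpow (by positivity) (by linarith) (by positivity)
    have h4 : K ^ 2 * k * 1 * 1 ≤ K ^ 2 * k * Real.log (2 * n) ^ (2 / α) * B ^ (2 / α) := by
      gcongr
      · exact Real.one_le_rpow hlog (by positivity)
      · exact Real.one_le_rpow hB1 (by positivity)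
    have h5 : 10 ^ 11 * G * (K ^ 2 * k * 1 * 1) ≤ n * (2 * (2 * K) ^ 2 * G) :=
      (mul_le_mul_of_nonneg_left h4 (by positivity)).trans
        (hsize.trans (mul_le_mul_of_nonneg_left (h1.trans (by gcongr)) hn0.le))
    have h6 : G * K ^ 2 * (10 ^ 11 * k) ≤ G * K ^ 2 * (8 * n) := by linarith
    have h7 := le_of_mul_le_mul_left h6 (by positivity)
    linarith
  have hexpT : Real.exp T = n * p := Real.exp_log hnp0
  have hpB : (p : ℝ) ≤ Real.exp B := by
    have h1 := Real.exp_le_exp.2 hTB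
    rw [hexpT] at h1
    nlinarith
  have hexpB : Real.exp (-B) ≤ 1 / ((n : ℝ) * p) := by
    rw [← hexpT, one_div, ← Real.exp_neg]
    exact Real.exp_le_exp.2 (by linarith)
  -- 67 = 64 + 1 + 1 + 1: the certificates, the factor p, the factor 2, and one exp(-B) left over to
  -- give 1/(np).
  have hcount : (2 * p + 1 : ℝ) ^ (64 * k) * (p * (2 * Real.exp (-(67 * B)))) ≤
      1 / ((n : ℝ) * p) := by
    have h1 : (2 * p + 1 : ℝ) ≤ Real.exp L := by
      rw [hL, Real.exp_log (by positivity), le_div_iff₀ hk0]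
      nlinarith
    have h2 : (2 * p + 1 : ℝ) ^ (64 * k) ≤ Real.exp (64 * B) := by
      refine (pow_le_pow_left₀ (by positivity) h1 _).trans (le_of_eq ?_)
      rw [← Real.exp_nat_mul, hB]
      push_cast
      ring_nf
    have h3 : (2 : ℝ) ≤ Real.exp B := by linarith [Real.add_one_le_exp B]
    calc (2 * p + 1 : ℝ) ^ (64 * k) * (p * (2 * Real.exp (-(67 * B))))
        ≤ Real.exp (64 * B) * (Real.exp B * (Real.exp B * Real.exp (-(67 * B)))) := by gcongr
      _ = Real.exp (-B) := by
          rw [← Real.exp_add, ← Real.exp_add, ← Real.exp_add]; ring_nf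
      _ ≤ _ := hexpB
  have hp2 : p * Real.exp (-(2 * B)) ≤ 1 / ((n : ℝ) * p) := by
    calc p * Real.exp (-(2 * B)) ≤ Real.exp B * Real.exp (-(2 * B)) := by gcongr
      _ = Real.exp (-B) := by rw [← Real.exp_add]; ring_nf
      _ ≤ _ := hexpB
  obtain ⟨bad₁, hbad₁, hre⟩ := SubWeibullLasso.restricted_eigenvalue (by omega) hlog hk hα hα2 hK hX
    (hind.comp (fun _ z => z.1) (fun _ => measurable_fst)) hbX hr0 hr.le hB1 hcount hp2 hsize
  obtain ⟨bad₂, hbad₂, hscore⟩ := SubWeibullLasso.score_event (by omega) hp hlog hT hγ0 hK hX hY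
    hind hmean fun i j => (hbX i j).mul (SubWeibullLasso.measurable_coord (hX i) j)
      (SubWeibullLasso.err_measurable hX hY β₀ i) hα hϑ hγ (by positivity) (hbe i)
  have hlam := SubWeibullLasso.lamChoice_pos (n := n) (p := p) (γ := γ) hn0 (by linarith)
    (by linarith) hK (SubWeibullLasso.lamConst_pos γ)
    (Real.sqrt_nonneg _ : 0 ≤ SubWeibullLasso.sigma μ X Y β₀)
  -- The bad sets carry no measurability claim, so their measurable hull is removed. The total loss
  -- 5/(np) is at most (3 + 3k)/(np).
  refine ⟨(toMeasurable μ (bad₁ ∪ bad₂))ᶜ, (measurableSet_toMeasurable _ _).compl, ?_, ?_⟩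
  · rw [probReal_compl_eq_one_sub (measurableSet_toMeasurable _ _), measureReal_def,
      measure_toMeasurable, ← measureReal_def]
    have h1 := measureReal_union_le (μ := μ) bad₁ bad₂
    have h2 : 1 / ((n : ℝ) * p) ≤ k / ((n : ℝ) * p) := by gcongr
    have h3 : 3 / ((n : ℝ) * p) = 3 * (1 / ((n : ℝ) * p)) := by ring
    have h4 : 3 * (k : ℝ) / ((n : ℝ) * p) = 3 * (k / ((n : ℝ) * p)) := by ring
    have h5 : 0 < 1 / ((n : ℝ) * p) := by positivity
    linarith
  intro ω hω
  have hω' : ω ∉ bad₁ ∪ bad₂ := fun h => hω (subset_toMeasurable _ _ h)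
  rw [Set.mem_union, not_or] at hω'
  refine ⟨SubWeibullLasso.exists_isLasso _ _ hlam, fun b hb => ?_⟩
  refine (hb.norm_sub_le hlam hβ (hscore ω hω'.2) hr0 (hre ω hω'.1)).trans ?_
  exact SubWeibullLasso.rate_le hn2 hp1 (by linarith) (by linarith) hγ0 hr0
    (SubWeibullLasso.lamConst_pos γ).le
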